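/- Conventions. All rings are commutative with identity. A normal domain is a noetherian integrally closed integral domain; fields count as principal ideal domains. A semidualizing module over a noetherian ring $R$ is a finitely generated $R$-module $C$ with $\operatorname{Hom}_R(C,C)\cong R$ and $\operatorname{Ext}_R^n(C,C)=0$ for all $n\ge 1$; $\mathfrak S_0(R)$ is the set of isomorphism classes of semidualizing $R$-modules. $\overline{\mathfrak S}_0(R)$ is the orbit space of $\mathfrak S_0(R)$ under the action $[\mathfrak a]+[C]=[\mathfrak a\otimes_R C]$ of $\operatorname{Pic}(R)$. For a normal domain $A$, $\operatorname{Cl}(A)$ is the divisor class group: the set of isomorphism classes of finitely generated reflexive $A$-modules of rank $1$, with $[\mathfrak a]+[\mathfrak b]=[(\mathfrak a\otimes_A\mathfrak b)^{**}]$. For a flat ring homomorphism $\varphi\colon A\to B$ (of normal domains in the case of $\operatorname{Cl}$, of noetherian rings otherwise), the maps $\operatorname{Cl}(\varphi)$ and $\mathfrak S_0(\varphi)$ are given by $[M]\mapsto[M\otimes_A B]$, and $\overline{\mathfrak S}_0(\varphi)$ is the map induced by $\mathfrak S_0(\varphi)$ on orbit spaces. Theorem 4.4. Let $D$ be a principal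 ideal domain, let $R_1,R_2$ be normal domains equipped with injective ring homomorphisms $D\to R_i$, and assume that $T=R_1\otimes_D R_2$ is a normal domain. Let $g_i\colon R_i\to T$ be the natural maps (which are flat). For $i=1,2$ let $h_i\colon T\to S_i$ be a flat ring homomorphism with $S_i$ a normal domain. Then for each of the rings $A=R_1,R_2,T,S_1,S_2$ one has $\mathfrak S_0(A)\subseteq\operatorname{Cl}(A)$, and $C_1\otimes_D C_2$ is a semidualizing $T$-module whenever $C_i$ is a semidualizing $R_i$-module for $i=1,2$. Hence there are well-defined maps $$\mathfrak S_0(g_1)\otimes\mathfrak S_0(g_2)\colon \mathfrak S_0(R_1)\times\mathfrak S_0(R_2)\to\mathfrak S_0(T),\quad ([C_1],[C_2])\mapsto[C_1\otimes_D C_2],$$ $$\operatorname{Cl}(g_1)+\operatorname{Cl}(g_2)\colon \operatorname{Cl}(R_1)\times\operatorname{Cl}(R_2)\to\operatorname{Cl}(T),\quad (x_1,x_2)\mapsto \operatorname{Cl}(g_1)(x_1)+\operatorname{Cl}(g_2)(x_2),$$ and the first of these induces a map $\overline{\mathfrak S}_0(g_1)\otimes\overline{\mathfrak S}_0(g_2)\colon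 \overline{\mathfrak S}_0(R_1)\times\overline{\mathfrak S}_0(R_2)\to\overline{\mathfrak S}_0(T)$ on orbit spaces. Consider the following three triangles (which are not claimed to commute): 1. $\operatorname{Cl}(g_1)+\operatorname{Cl}(g_2)\colon\operatorname{Cl}(R_1)\times\operatorname{Cl}(R_2)\to\operatorname{Cl}(T)$, $(\operatorname{Cl}(h_1),\operatorname{Cl}(h_2))\colon\operatorname{Cl}(T)\to\operatorname{Cl}(S_1)\times\operatorname{Cl}(S_2)$, and $\operatorname{Cl}(h_1\circ g_1)\times\operatorname{Cl}(h_2\circ g_2)\colon\operatorname{Cl}(R_1)\times\operatorname{Cl}(R_2)\to\operatorname{Cl}(S_1)\times\operatorname{Cl}(S_2)$; 2. $\mathfrak S_0(g_1)\otimes\mathfrak S_0(g_2)\colon\mathfrak S_0(R_1)\times\mathfrak S_0(R_2)\to\mathfrak S_0(T)$, $(\mathfrak S_0(h_1),\mathfrak S_0(h_2))\colon\mathfrak S_0(T)\to\mathfrak S_0(S_1)\times\mathfrak S_0(S_2)$, and $\mathfrak S_0(h_1\circ g_1)\times\mathfrak S_0(h_2\circ g_2)\colon\mathfrak S_0(R_1)\times\mathfrak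 S_0(R_2)\to\mathfrak S_0(S_1)\times\mathfrak S_0(S_2)$; 3. the triangle obtained from triangle 2 by replacing $\mathfrak S_0$ with $\overline{\mathfrak S}_0$ throughout. Map triangle 2 to triangle 1 by the inclusions $\mathfrak S_0\subseteq\operatorname{Cl}$, and map triangle 2 to triangle 3 by the projections $\mathfrak S_0\to\overline{\mathfrak S}_0$. Then the six resulting quadrilaterals (one for each of the three edges, in each of the two prisms) commute. -/

import Mathlib

set_option linter.unusedSectionVars false

universe u

open TensorProduct CategoryTheory CategoryTheory.Abelian

noncomputable section

namespace SDM

/-! ### Isomorphism classes of modules -/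

/-- Isomorphism classes of `R`-modules (in the universe of `R`, which suffices for finitely
generated modules). -/
def IsoClass (R : Type u) [CommRing R] : Type (u + 1) :=
  Quotient (isIsomorphicSetoid (ModuleCat.{u} R))

namespace IsoClass

/-- The isomorphism class `[M]`. -/
def mk (R : Type u) [CommRing R] (M : Type u) [AddCommGroup M] [Module R M] : IsoClass R :=
  Quotient.mk (isIsomorphicSetoid (ModuleCat.{u} R)) (ModuleCat.of R M)

theorem mk_eq_mk_iff {R : Type u} [CommRing R] {M N : Type u} [AddCommGroup M] [Module R M]
    [AddCommGroup N] [Module R N] : mk R M = mk R N ↔ Nonempty (M ≃ₗ[R] N) := by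
  refine Quotient.eq.trans ⟨?_, ?_⟩
  · rintro ⟨e⟩; exact ⟨e.toLinearEquiv⟩
  · rintro ⟨e⟩; exact ⟨e.toModuleIso⟩

theorem mk_eq {R : Type u} [CommRing R] {M N : Type u} [AddCommGroup M] [Module R M]
    [AddCommGroup N] [Module R N] (e : M ≃ₗ[R] N) : mk R M = mk R N := mk_eq_mk_iff.2 ⟨e⟩

theorem ind {R : Type u} [CommRing R] {P : IsoClass R → Prop}
    (h : ∀ (M : Type u) [AddCommGroup M] [Module R M], P (mk R M)) (x : IsoClass R) : P x :=
  Quotient.inductionOn x fun M => h M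

/-- `[M] ↦ [S ⊗_R M]` along a ring homomorphism `φ : R → S`. -/
def baseChange {R S : Type u} [CommRing R] [CommRing S] (φ : R →+* S) : IsoClass R → IsoClass S :=
  letI := φ.toAlgebra
  Quotient.lift (s := isIsomorphicSetoid (ModuleCat.{u} R)) (fun M => mk S (S ⊗[R] M))
    (by rintro M N ⟨e⟩; exact mk_eq (e.toLinearEquiv.baseChange R S M N))

theorem baseChange_mk {R S : Type u} [CommRing R] [CommRing S] (φ : R →+* S)
    (M : Type u) [AddCommGroup M] [Module R M] :
    letI := φ.toAlgebra
    baseChange φ (mk R M) = mk S (S ⊗[R] M) := rfl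

/-- `([M], [N]) ↦ [M ⊗_R N]`. -/
def tensor {R : Type u} [CommRing R] : IsoClass R → IsoClass R → IsoClass R :=
  Quotient.lift₂ (s₁ := isIsomorphicSetoid (ModuleCat.{u} R))
    (s₂ := isIsomorphicSetoid (ModuleCat.{u} R)) (fun M N => mk R (M ⊗[R] N))
    (by rintro M N M' N' ⟨e⟩ ⟨e'⟩
        exact mk_eq (TensorProduct.congr e.toLinearEquiv e'.toLinearEquiv))

/-- `[M] ↦ [Hom_R(M, R)]`. -/
def dual {R : Type u} [CommRing R] : IsoClass R → IsoClass R :=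
  Quotient.lift (s := isIsomorphicSetoid (ModuleCat.{u} R)) (fun M => mk R (Module.Dual R M))
    (by rintro M N ⟨e⟩; exact mk_eq e.toLinearEquiv.dualMap.symm)

end IsoClass

/-! ### External tensor product -/

section External
variable (D R₁ R₂ : Type u) [CommRing D] [CommRing R₁] [CommRing R₂] [Algebra D R₁] [Algebra D R₂]
  (M₁ M₂ : Type u) [AddCommGroup M₁] [AddCommGroup M₂] [Module R₁ M₁] [Module R₂ M₂]
  [Module D M₁] [Module D M₂] [IsScalarTower D R₁ M₁] [IsScalarTower D R₂ M₂]

/-- The module `M₁ ⊗_D M₂`, to be regarded as a module over `R₁ ⊗_D R₂`. -/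
def ExtTensor : Type u := M₁ ⊗[D] M₂

instance : AddCommGroup (ExtTensor D M₁ M₂) := inferInstanceAs (AddCommGroup (M₁ ⊗[D] M₂))

instance : Module D (ExtTensor D M₁ M₂) := inferInstanceAs (Module D (M₁ ⊗[D] M₂))

/-- The action of `R₁ ⊗_D R₂` on `M₁ ⊗_D M₂`; on pure tensors it is
`(r₁ ⊗ r₂) • (m₁ ⊗ m₂) = (r₁ • m₁) ⊗ (r₂ • m₂)`, see `ExtTensor.tmul_smul_tmul`. -/
def ExtTensor.action : R₁ ⊗[D] R₂ →ₐ[D] Module.End D (ExtTensor D M₁ M₂) :=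
  (Module.endTensorEndAlgHom (R := D) (S := D) (A := D) (M := M₁) (N := M₂)).comp
    (Algebra.TensorProduct.map (Algebra.lsmul D D M₁) (Algebra.lsmul D D M₂))

instance : Module (R₁ ⊗[D] R₂) (ExtTensor D M₁ M₂) :=
  Module.compHom _ (ExtTensor.action D R₁ R₂ M₁ M₂).toRingHom

variable {D R₁ R₂ M₁ M₂}
/-- Pure tensors of `M₁ ⊗_D M₂`. -/
def ExtTensor.tmul (D : Type u) [CommRing D] [Module D M₁] [Module D M₂] (m₁ : M₁) (m₂ : M₂) : ExtTensor D M₁ M₂ := m₁ ⊗ₜ[D] m₂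

theorem ExtTensor.tmul_smul_tmul (r₁ : R₁) (r₂ : R₂) (m₁ : M₁) (m₂ : M₂) :
    (r₁ ⊗ₜ[D] r₂) • tmul D m₁ m₂ = tmul D (r₁ • m₁) (r₂ • m₂) := rfl

instance : IsScalarTower D (R₁ ⊗[D] R₂) (ExtTensor D M₁ M₂) :=
  .of_algebraMap_smul fun d x => by
    change ExtTensor.action D R₁ R₂ M₁ M₂ (algebraMap _ _ d) x = _
    rw [AlgHom.commutes]; rfl

namespace ExtTensor
variable {N₁ N₂ : Type u} [AddCommGroup N₁] [AddCommGroup N₂] [Module R₁ N₁] [Module R₂ N₂]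
  [Module D N₁] [Module D N₂] [IsScalarTower D R₁ N₁] [IsScalarTower D R₂ N₂]

theorem smul_def (t : R₁ ⊗[D] R₂) (x : ExtTensor D M₁ M₂) :
    t • x = ExtTensor.action D R₁ R₂ M₁ M₂ t x := rfl

@[elab_as_elim]
theorem induction {P : ExtTensor D M₁ M₂ → Prop} (zero : P 0)
    (tmul : ∀ m₁ m₂, P (tmul D m₁ m₂)) (add : ∀ x y, P x → P y → P (x + y))
    (x : ExtTensor D M₁ M₂) : P x :=
  TensorProduct.induction_on (motive := P) x zero tmul add

theorem linear_of_pure {P : Type u} [AddCommGroup P] [Module (R₁ ⊗[D] R₂) P]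
    (f : ExtTensor D M₁ M₂ →+ P)
    (h : ∀ (r₁ : R₁) (r₂ : R₂) (m₁ : M₁) (m₂ : M₂),
      f (tmul D (r₁ • m₁) (r₂ • m₂)) = (r₁ ⊗ₜ[D] r₂) • f (tmul D m₁ m₂))
    (t : R₁ ⊗[D] R₂) (x : ExtTensor D M₁ M₂) : f (t • x) = t • f x := by
  induction t using TensorProduct.induction_on with
  | zero => simp
  | add a b ha hb => rw [add_smul, map_add, ha, hb, add_smul]
  | tmul r₁ r₂ =>
    induction x using ExtTensor.induction with
    | zero => simp
    | add a b ha hb => rw [smul_add, map_add, ha, hb, map_add, smul_add]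
    | tmul m₁ m₂ => exact h r₁ r₂ m₁ m₂

/-- Functoriality of `M₁ ⊗_D M₂` for isomorphisms. -/
def congr (e₁ : M₁ ≃ₗ[R₁] N₁) (e₂ : M₂ ≃ₗ[R₂] N₂) :
    ExtTensor D M₁ M₂ ≃ₗ[R₁ ⊗[D] R₂] ExtTensor D N₁ N₂ :=
  let e : M₁ ⊗[D] M₂ ≃ₗ[D] N₁ ⊗[D] N₂ :=
    TensorProduct.congr (e₁.restrictScalars D) (e₂.restrictScalars D)
  { e with
    map_smul' := fun t x => linear_of_pure (P := ExtTensor D N₁ N₂)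
      (e.toAddMonoidHom : M₁ ⊗[D] M₂ →+ N₁ ⊗[D] N₂) (fun r₁ r₂ m₁ m₂ => by
        change e ((r₁ • m₁) ⊗ₜ[D] (r₂ • m₂)) = (r₁ ⊗ₜ[D] r₂) • (tmul D (e₁ m₁) (e₂ m₂))
        rw [tmul_smul_tmul]
        change (e₁ (r₁ • m₁)) ⊗ₜ[D] (e₂ (r₂ • m₂)) = (r₁ • e₁ m₁) ⊗ₜ[D] (r₂ • e₂ m₂)
        rw [map_smul, map_smul]) t x }

end ExtTensor
end External

section Interchange

/-- Additive maps out of `A ⊗_R B` from balanced biadditive maps. -/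
def lift₂ {R A B X : Type u} [CommRing R] [AddCommGroup A] [AddCommGroup B] [AddCommGroup X]
    [Module R A] [Module R B] (f : A → B → X)
    (h₁ : ∀ a a' b, f (a + a') b = f a b + f a' b) (h₂ : ∀ a b b', f a (b + b') = f a b + f a b')
    (h : ∀ (r : R) a b, f (r • a) b = f a (r • b)) : A ⊗[R] B →+ X :=
  TensorProduct.liftAddHom
    (AddMonoidHom.mk' (fun a => AddMonoidHom.mk' (f a) (h₂ a)) fun a a' => by ext b; exact h₁ a a' b)
    h

/-- A two-fold version of `lift₂`. -/
def lift₄ {S₁ S₂ A B C E X : Type u} [CommRing S₁] [CommRing S₂]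
    [AddCommGroup A] [AddCommGroup B] [AddCommGroup C] [AddCommGroup E] [AddCommGroup X]
    [Module S₁ A] [Module S₁ B] [Module S₂ C] [Module S₂ E] (f : A → B → C → E → X)
    (h₁ : ∀ a a' b c e, f (a + a') b c e = f a b c e + f a' b c e)
    (h₂ : ∀ a b b' c e, f a (b + b') c e = f a b c e + f a b' c e)
    (h₃ : ∀ a b c c' e, f a b (c + c') e = f a b c e + f a b c' e)
    (h₄ : ∀ a b c e e', f a b c (e + e') = f a b c e + f a b c e')
    (hs₁ : ∀ (r : S₁) a b c e, f (r • a) b c e = f a (r • b) c e)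
    (hs₂ : ∀ (r : S₂) a b c e, f a b (r • c) e = f a b c (r • e)) :
    A ⊗[S₁] B →+ C ⊗[S₂] E →+ X :=
  have ext {g g' : C ⊗[S₂] E →+ X} (h : ∀ c e, g (c ⊗ₜ e) = g' (c ⊗ₜ e)) : g = g' := by
    ext x
    induction x using TensorProduct.induction_on with
    | zero => simp
    | add a b ha hb => rw [map_add, map_add, ha, hb]
    | tmul c e => exact h c e
  lift₂ (fun a b => lift₂ (f a b) (h₃ a b) (h₄ a b) (fun r => hs₂ r a b))
    (fun a a' b => ext fun c e => h₁ a a' b c e)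
    (fun a b b' => ext fun c e => h₂ a b b' c e)
    (fun r a b => ext fun c e => hs₁ r a b c e)

variable {D R₁ R₂ : Type u} [CommRing D] [CommRing R₁] [CommRing R₂] [Algebra D R₁] [Algebra D R₂]
  (P₁ P₂ M₁ M₂ : Type u) [AddCommGroup M₁] [AddCommGroup M₂] [Module R₁ M₁] [Module R₂ M₂]
  [AddCommGroup P₁] [AddCommGroup P₂] [Module R₁ P₁] [Module R₂ P₂]
  [Module D M₁] [Module D M₂] [IsScalarTower D R₁ M₁] [IsScalarTower D R₂ M₂]
  [Module D P₁] [Module D P₂] [IsScalarTower D R₁ P₁] [IsScalarTower D R₂ P₂]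

namespace ExtTensor

theorem add_tmul (a a' : M₁) (b : M₂) : tmul D (a + a') b = tmul D a b + tmul D a' b :=
  TensorProduct.add_tmul a a' b

theorem tmul_add (a : M₁) (b b' : M₂) : tmul D a (b + b') = tmul D a b + tmul D a b' :=
  TensorProduct.tmul_add a b b'

theorem zero_tmul (b : M₂) : tmul D (0 : M₁) b = 0 := TensorProduct.zero_tmul M₁ b

theorem tmul_zero (a : M₁) : tmul D a (0 : M₂) = 0 := TensorProduct.tmul_zero M₂ a

theorem smul_tmul₁ (r : R₁) (a : M₁) (b : M₂) :
    tmul D (r • a) b = (r ⊗ₜ[D] (1 : R₂)) • tmul D a b := by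
  rw [tmul_smul_tmul, one_smul]

theorem smul_tmul₂ (r : R₂) (a : M₁) (b : M₂) :
    tmul D a (r • b) = ((1 : R₁) ⊗ₜ[D] r) • tmul D a b := by
  rw [tmul_smul_tmul, one_smul]

/-- The forward map of `interchange`. -/
def interchangeFun : ExtTensor D (P₁ ⊗[R₁] M₁) (P₂ ⊗[R₂] M₂) →+
    ExtTensor D P₁ P₂ ⊗[R₁ ⊗[D] R₂] ExtTensor D M₁ M₂ :=
  TensorProduct.liftAddHom
    (lift₄ (fun p₁ m₁ p₂ m₂ => tmul D p₁ p₂ ⊗ₜ tmul D m₁ m₂)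
      (fun _ _ _ _ _ => by rw [add_tmul, TensorProduct.add_tmul])
      (fun _ _ _ _ _ => by rw [add_tmul, TensorProduct.tmul_add])
      (fun _ _ _ _ _ => by rw [tmul_add, TensorProduct.add_tmul])
      (fun _ _ _ _ _ => by rw [tmul_add, TensorProduct.tmul_add])
      (fun _ _ _ _ _ => by rw [smul_tmul₁ (R₂ := R₂), smul_tmul₁ (R₂ := R₂), TensorProduct.smul_tmul])
      (fun _ _ _ _ _ => by rw [smul_tmul₂ (R₁ := R₁), smul_tmul₂ (R₁ := R₁), TensorProduct.smul_tmul]))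
    (fun d x y => by
      induction x using TensorProduct.induction_on with
      | zero => simp
      | add a b ha hb => rw [smul_add, map_add, map_add, AddMonoidHom.add_apply, ha, hb]; rfl
      | tmul p₁ m₁ =>
        induction y using TensorProduct.induction_on with
        | zero => simp
        | add a b ha hb => rw [smul_add, map_add, map_add, ha, hb]
        | tmul p₂ m₂ =>
          change tmul D (d • p₁) p₂ ⊗ₜ[R₁ ⊗[D] R₂] tmul D m₁ m₂ = tmul D p₁ (d • p₂) ⊗ₜ tmul D m₁ m₂
          congr 1
          exact TensorProduct.smul_tmul d p₁ p₂)

/-- The curried inverse map of `interchange`. -/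
def interchangeInvAux : ExtTensor D P₁ P₂ →+ ExtTensor D M₁ M₂ →+
    ExtTensor D (P₁ ⊗[R₁] M₁) (P₂ ⊗[R₂] M₂) :=
  (lift₄ (S₁ := D) (S₂ := D) (A := P₁) (B := P₂) (C := M₁) (E := M₂)
    (fun p₁ p₂ m₁ m₂ => tmul D (p₁ ⊗ₜ[R₁] m₁) (p₂ ⊗ₜ[R₂] m₂))
    (fun _ _ _ _ _ => by rw [TensorProduct.add_tmul, add_tmul])
    (fun _ _ _ _ _ => by rw [TensorProduct.add_tmul, tmul_add])
    (fun _ _ _ _ _ => by rw [TensorProduct.tmul_add, add_tmul])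
    (fun _ _ _ _ _ => by rw [TensorProduct.tmul_add, tmul_add])
    (fun d p₁ p₂ m₁ m₂ => TensorProduct.smul_tmul d (p₁ ⊗ₜ[R₁] m₁) (p₂ ⊗ₜ[R₂] m₂))
    (fun d p₁ p₂ m₁ m₂ => by
      rw [TensorProduct.tmul_smul, TensorProduct.tmul_smul]
      exact TensorProduct.smul_tmul d (p₁ ⊗ₜ[R₁] m₁) (p₂ ⊗ₜ[R₂] m₂)) :
    P₁ ⊗[D] P₂ →+ M₁ ⊗[D] M₂ →+ ExtTensor D (P₁ ⊗[R₁] M₁) (P₂ ⊗[R₂] M₂))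

/-- The inverse map of `interchange`. -/
def interchangeInv : ExtTensor D P₁ P₂ ⊗[R₁ ⊗[D] R₂] ExtTensor D M₁ M₂ →+
    ExtTensor D (P₁ ⊗[R₁] M₁) (P₂ ⊗[R₂] M₂) :=
  TensorProduct.liftAddHom (interchangeInvAux P₁ P₂ M₁ M₂)
    (fun t x y => by
      induction t using TensorProduct.induction_on with
      | zero => simp
      | add a b ha hb =>
        rw [add_smul, add_smul, map_add, map_add, ← ha, ← hb, AddMonoidHom.add_apply]
      | tmul r₁ r₂ =>
        induction x using ExtTensor.induction with
        | zero => simp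
        | add a b ha hb =>
          rw [smul_add, map_add, map_add, AddMonoidHom.add_apply, AddMonoidHom.add_apply, ha, hb]
        | tmul p₁ p₂ =>
          induction y using ExtTensor.induction with
          | zero => rw [smul_zero, map_zero, map_zero]
          | add a b ha hb => rw [smul_add, map_add, map_add, ha, hb]
          | tmul m₁ m₂ =>
            change tmul D ((r₁ • p₁) ⊗ₜ[R₁] m₁) ((r₂ • p₂) ⊗ₜ[R₂] m₂) =
              tmul D (p₁ ⊗ₜ[R₁] (r₁ • m₁)) (p₂ ⊗ₜ[R₂] (r₂ • m₂))
            rw [TensorProduct.smul_tmul, TensorProduct.smul_tmul])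

/-- The isomorphism `(P₁ ⊗_{R₁} M₁) ⊗_D (P₂ ⊗_{R₂} M₂) ≅ (P₁ ⊗_D P₂) ⊗_T (M₁ ⊗_D M₂)` over
`T = R₁ ⊗_D R₂`. -/
def interchange : ExtTensor D (P₁ ⊗[R₁] M₁) (P₂ ⊗[R₂] M₂) ≃ₗ[R₁ ⊗[D] R₂]
    ExtTensor D P₁ P₂ ⊗[R₁ ⊗[D] R₂] ExtTensor D M₁ M₂ where
  toFun := interchangeFun P₁ P₂ M₁ M₂
  invFun := interchangeInv P₁ P₂ M₁ M₂
  map_add' := map_add _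
  map_smul' := linear_of_pure _ fun r₁ r₂ x y => by
    induction x using TensorProduct.induction_on with
    | zero => rw [smul_zero, zero_tmul, zero_tmul, map_zero, smul_zero]
    | add a b ha hb => rw [smul_add, add_tmul, add_tmul, map_add, map_add, ha, hb, smul_add]
    | tmul p₁ m₁ =>
      induction y using TensorProduct.induction_on with
      | zero => rw [smul_zero, tmul_zero, tmul_zero, map_zero, smul_zero]
      | add a b ha hb => rw [smul_add, tmul_add, tmul_add, map_add, map_add, ha, hb, smul_add]
      | tmul p₂ m₂ => rfl
  left_inv x := by
    induction x using ExtTensor.induction with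
    | zero => simp
    | add a b ha hb => rw [map_add, map_add, ha, hb]
    | tmul x y =>
      induction x using TensorProduct.induction_on with
      | zero => rw [zero_tmul, map_zero, map_zero]
      | add a b ha hb => rw [add_tmul, map_add, map_add, ha, hb]
      | tmul p₁ m₁ =>
        induction y using TensorProduct.induction_on with
        | zero => rw [tmul_zero, map_zero, map_zero]
        | add a b ha hb => rw [tmul_add, map_add, map_add, ha, hb]
        | tmul p₂ m₂ => rfl
  right_inv x := by
    induction x using TensorProduct.induction_on with
    | zero => simp
    | add a b ha hb => rw [map_add, map_add, ha, hb]
    | tmul x y =>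
      induction x using ExtTensor.induction with
      | zero => rw [TensorProduct.zero_tmul, map_zero, map_zero]
      | add a b ha hb => rw [TensorProduct.add_tmul, map_add, map_add, ha, hb]
      | tmul p₁ m₁ =>
        induction y using ExtTensor.induction with
        | zero => rw [TensorProduct.tmul_zero, map_zero, map_zero]
        | add a b ha hb => rw [TensorProduct.tmul_add, map_add, map_add, ha, hb]
        | tmul p₂ m₂ => rfl

end ExtTensor
end Interchange


/-- `([M₁], [M₂]) ↦ [M₁ ⊗_D M₂]`, the class of an `R₁ ⊗_D R₂`-module. The `D`-module structures on
`M₁` and `M₂` are those induced by `D → R₁` and `D → R₂`. -/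
def IsoClass.extTensor {D R₁ R₂ : Type u} [CommRing D] [CommRing R₁] [CommRing R₂]
    [Algebra D R₁] [Algebra D R₂] : IsoClass R₁ → IsoClass R₂ → IsoClass (R₁ ⊗[D] R₂) :=
  letI (M : ModuleCat.{u} R₁) : Module D M := Module.compHom M (algebraMap D R₁)
  letI (M : ModuleCat.{u} R₂) : Module D M := Module.compHom M (algebraMap D R₂)
  haveI (M : ModuleCat.{u} R₁) : IsScalarTower D R₁ M := .of_algebraMap_smul fun _ _ => rfl
  haveI (M : ModuleCat.{u} R₂) : IsScalarTower D R₂ M := .of_algebraMap_smul fun _ _ => rfl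
  Quotient.lift₂ (s₁ := isIsomorphicSetoid (ModuleCat.{u} R₁))
    (s₂ := isIsomorphicSetoid (ModuleCat.{u} R₂))
    (fun M₁ M₂ => mk (R₁ ⊗[D] R₂) (ExtTensor D M₁ M₂))
    (by rintro M N M' N' ⟨e⟩ ⟨e'⟩
        exact mk_eq (ExtTensor.congr e.toLinearEquiv e'.toLinearEquiv))

theorem IsoClass.extTensor_mk {D R₁ R₂ : Type u} [CommRing D] [CommRing R₁] [CommRing R₂]
    [Algebra D R₁] [Algebra D R₂]
  (M₁ M₂ : Type u) [AddCommGroup M₁] [AddCommGroup M₂] [Module R₁ M₁] [Module R₂ M₂]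
  [Module D M₁] [Module D M₂] [IsScalarTower D R₁ M₁] [IsScalarTower D R₂ M₂] :
   extTensor (D := D) (mk R₁ M₁) (mk R₂ M₂) = mk (R₁ ⊗[D] R₂) (ExtTensor D M₁ M₂) := by
  have h1 : ‹Module D M₁› = Module.compHom M₁ (algebraMap D R₁) :=
    Module.ext' _ _ fun d m => (algebraMap_smul R₁ d m).symm
  have h2 : ‹Module D M₂› = Module.compHom M₂ (algebraMap D R₂) :=
    Module.ext' _ _ fun d m => (algebraMap_smul R₂ d m).symm
  subst h1 h2
  rfl


/-! ### Rank, duality and reflexivity over a domain -/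

section
variable (A : Type u) [CommRing A] [IsDomain A]

theorem rank_tensor (M N : Type u) [AddCommGroup M] [Module A M] [AddCommGroup N] [Module A N]  :
    Module.rank A (M ⊗[A] N) = Module.rank A M * Module.rank A N := by
  let K := FractionRing A
  have key (P : Type u) [AddCommGroup P] [Module A P] :
      Module.rank K (K ⊗[A] P) = Module.rank A P := by
    rw [IsLocalization.rank_eq K (nonZeroDivisors A) le_rfl]
    exact IsLocalizedModule.rank_eq (nonZeroDivisors A) le_rfl (TensorProduct.mk A K P 1)
  rw [← key, ← key, ← key, (AlgebraTensorModule.distribBaseChange A K M N).rank_eq, rank_tensorProduct']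

theorem rank_dual [IsNoetherianRing A] (M : Type u) [AddCommGroup M] [Module A M] [Module.Finite A M] :
    Module.rank A (Module.Dual A M) = Module.rank A M := by
  let K := FractionRing A
  have key (P : Type u) [AddCommGroup P] [Module A P] :
      Module.rank K (K ⊗[A] P) = Module.rank A P := by
    rw [IsLocalization.rank_eq K (nonZeroDivisors A) le_rfl]
    exact IsLocalizedModule.rank_eq (nonZeroDivisors A) le_rfl (TensorProduct.mk A K P 1)
  have : Module.FinitePresentation A M := Module.finitePresentation_of_finite A M
  let f := IsLocalizedModule.mapExtendScalars (nonZeroDivisors A) (TensorProduct.mk A K M 1)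
    (Algebra.linearMap A K) K
  rw [← IsLocalizedModule.rank_eq (nonZeroDivisors A) le_rfl f,
    ← IsLocalization.rank_eq K (nonZeroDivisors A) le_rfl, ← key M]
  rw [← Module.finrank_eq_rank, ← Module.finrank_eq_rank]
  exact congrArg _ (Subspace.dual_finrank_eq (K := K) (V := K ⊗[A] M))

theorem reflexive_dual [IsNoetherianRing A] (M : Type u) [AddCommGroup M] [Module A M] [Module.Finite A M] :
    Module.IsReflexive A (Module.Dual A M) := by
  let s := (Module.Dual.eval A M).dualMap
  have hs : Function.LeftInverse s (Module.Dual.eval A (Module.Dual A M)) := fun f => by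
    ext m; rfl
  have hk : LinearMap.ker s = ⊥ := by
    have h1 := rank_quotient_add_rank_of_isDomain (LinearMap.ker s)
    rw [(s.quotKerEquivOfSurjective hs.surjective).rank_eq] at h1
    simp only [rank_dual] at h1
    have h2 : Module.rank A (LinearMap.ker s) = 0 := by
      have : Module.rank A M < Cardinal.aleph0 := Module.rank_lt_aleph0 A M
      exact Cardinal.eq_of_add_eq_add_left (h1.trans (add_zero _).symm) this
    rw [Submodule.rank_eq_zero] at h2
    exact h2
  refine ⟨hs.injective, fun φ => ⟨s φ, ?_⟩⟩
  exact LinearMap.ker_eq_bot.1 hk (hs _)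

/-- `(M** ⊗ N)* ≅ (M ⊗ N)*`. -/
def dualTensorEquiv [IsNoetherianRing A] (M N : Type u) [AddCommGroup M] [Module A M] [Module.Finite A M]
    [AddCommGroup N] [Module A N] :
    Module.Dual A (Module.Dual A (Module.Dual A M) ⊗[A] N) ≃ₗ[A] Module.Dual A (M ⊗[A] N) :=
  have := reflexive_dual A M
  (TensorProduct.comm A N _).dualMap ≪≫ₗ (TensorProduct.lift.equiv (.id A) N _ A).symm ≪≫ₗ
    (Module.evalEquiv A (Module.Dual A M)).symm.congrRight ≪≫ₗ
    TensorProduct.lift.equiv (.id A) N M A ≪≫ₗ (TensorProduct.comm A N M).symm.dualMap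

theorem bijective_lsmul [IsNoetherianRing A] [IsIntegrallyClosed A] (M : Type u) [AddCommGroup M] [Module A M]
    [Module.Finite A M] [Module.IsReflexive A M] (h : Module.rank A M = 1) :
    Function.Bijective (LinearMap.lsmul A M) := by
  let K := FractionRing A
  have key : Module.finrank K (K ⊗[A] M) = 1 := by
    rw [Module.finrank, IsLocalization.rank_eq K (nonZeroDivisors A) le_rfl,
      IsLocalizedModule.rank_eq (nonZeroDivisors A) le_rfl (TensorProduct.mk A K M 1), h]
    simp
  have hnt : Nontrivial M := by
    by_contra hn
    rw [not_nontrivial_iff_subsingleton] at hn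
    rw [rank_subsingleton'] at h
    exact zero_ne_one h
  constructor
  · intro a b hab
    obtain ⟨m, hm⟩ := exists_ne (0 : M)
    have := LinearMap.congr_fun hab m
    simp only [LinearMap.lsmul_apply] at this
    exact smul_left_injective A hm this
  · intro f
    obtain ⟨c, hc⟩ : ∃ c : K, f.baseChange K = algebraMap K (Module.End K (K ⊗[A] M)) c := by
      obtain ⟨c, hc, -⟩ := LinearMap.existsUnique_eq_smul_id_of_finrank_eq_one key (f.baseChange K)
      exact ⟨c, by rw [hc]; rfl⟩
    have hint : IsIntegral A c := by
      have h1 : IsIntegral A f := Algebra.IsIntegral.isIntegral f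
      have h2 := h1.map (Module.End.baseChangeHom A K M)
      have h3 : Module.End.baseChangeHom A K M f = f.baseChange K := rfl
      rw [h3, hc] at h2
      have : Nontrivial (K ⊗[A] M) := Module.nontrivial_of_finrank_pos (R := K) (by rw [key]; exact one_pos)
      exact (isIntegral_algebraMap_iff (algebraMap K (Module.End K (K ⊗[A] M))).injective).1 h2
    obtain ⟨a, rfl⟩ := IsIntegrallyClosed.isIntegral_iff.1 hint
    refine ⟨a, LinearMap.ext fun m => ?_⟩
    have hinj : Function.Injective (TensorProduct.mk A K M 1) := by
      intro x y hxy
      obtain ⟨t, ht⟩ := (IsLocalizedModule.eq_iff_exists (nonZeroDivisors A)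
        (TensorProduct.mk A K M 1)).1 hxy
      exact smul_right_injective M (nonZeroDivisors.ne_zero t.2) ht
    apply hinj
    have := LinearMap.congr_fun hc (1 ⊗ₜ m)
    rw [LinearMap.baseChange_tmul] at this
    refine Eq.trans ?_ this.symm
    rw [Module.algebraMap_end_apply, algebraMap_smul]
    simp

theorem reflexive_baseChange [IsNoetherianRing A] (B : Type u) [CommRing B] [Algebra A B] [Module.Flat A B]
   (M : Type u) [AddCommGroup M] [Module A M]
    [Module.Finite A M] [Module.IsReflexive A M] : Module.IsReflexive B (B ⊗[A] M) := by
  have fp (N : Type u) [AddCommGroup N] [Module A N] [Module.Finite A N] :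
    Module.FinitePresentation A N := Module.finitePresentation_of_finite A N
  have e (N : Type u) [AddCommGroup N] [Module A N] [Module.Finite A N] :
     ∃ e : B ⊗[A] Module.Dual A N ≃ₗ[B] Module.Dual B (B ⊗[A] N), ∀ f : Module.Dual A N, ∀ n : N,
       e (1 ⊗ₜ f) (1 ⊗ₜ n) = algebraMap A B (f n) := by
    have := fp N
    have h := Module.FinitePresentation.isBaseChange_map A N A B
    refine ⟨h.equiv ≪≫ₗ (AlgebraTensorModule.rid A B B).congrRight, fun f n => ?_⟩
    simp only [LinearEquiv.trans_apply, IsBaseChange.equiv_tmul, one_smul]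
    change AlgebraTensorModule.rid A B B (LinearMap.baseChange B f (1 ⊗ₜ n)) = _
    simp [Algebra.algebraMap_eq_smul_one]
  obtain ⟨e1, h1⟩ := e M
  obtain ⟨e2, h2⟩ := e (Module.Dual A M)
  have : Module.Dual.eval B (B ⊗[A] M) =
     (((Module.evalEquiv A M).baseChange A B _ _ ≪≫ₗ e2) ≪≫ₗ e1.symm.dualMap).toLinearMap := by
    ext m g
    obtain ⟨g, rfl⟩ := e1.surjective g
    simp
    induction g using TensorProduct.induction_on with
    | zero => simp
    | add a b ha hb => simp [ha, hb]
    | tmul b f =>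
      rw [show b ⊗ₜ[A] f = b • ((1 : B) ⊗ₜ[A] f) by simp [smul_tmul'], map_smul, map_smul, h2]
      simp [h1]
  exact ⟨by rw [this]; exact LinearEquiv.bijective _⟩

theorem rank_baseChange_flat [IsNoetherianRing A] (B : Type u) [CommRing B] [IsDomain B] [Algebra A B] [Module.Flat A B]
   (M : Type u) [AddCommGroup M] [Module A M] : Module.rank B (B ⊗[A] M) = Module.rank A M := by
  have : Module.IsTorsionFree A B := inferInstance
  simpa using (TensorProduct.isBaseChange A M B).lift_rank_eq
end

/-! ### Vanishing of Ext under flat base change -/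

section
variable {A : Type u} [CommRing A]

theorem subsingleton_ext_of_iso {M M' N N' : ModuleCat.{u} A} (e : M ≅ M') (e' : N ≅ N') (n : ℕ)
    [Subsingleton (Ext M N n)] : Subsingleton (Ext M' N' n) := by
  refine ⟨fun x y => ?_⟩
  have key (z : Ext M' N' n) : z = (Ext.mk₀ e.inv).comp (((Ext.mk₀ e.hom).comp z (zero_add n)).comp
      (Ext.mk₀ e'.inv) (add_zero n) |>.comp (Ext.mk₀ e'.hom) (add_zero n)) (zero_add n) := by
    simp
  rw [key x, key y, Subsingleton.elim (((Ext.mk₀ e.hom).comp x (zero_add n)).comp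
      (Ext.mk₀ e'.inv) (add_zero n)) (((Ext.mk₀ e.hom).comp y (zero_add n)).comp
      (Ext.mk₀ e'.inv) (add_zero n))]

theorem subsingleton_ext_one_iff {S : ShortComplex (ModuleCat.{u} A)} (h : S.ShortExact)
    [Projective S.X₂] (N : ModuleCat.{u} A) :
    Subsingleton (Ext S.X₃ N 1) ↔ ∀ g : S.X₁ ⟶ N, ∃ k : S.X₂ ⟶ N, S.f ≫ k = g := by
  constructor
  · intro hs g
    obtain ⟨x, hx⟩ := Ext.contravariant_sequence_exact₁ h N (Ext.mk₀ g) (add_zero 1)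
      (Subsingleton.elim _ _)
    obtain ⟨k, rfl⟩ := (Ext.mk₀_bijective _ _).2 x
    refine ⟨k, (Ext.mk₀_bijective _ _).1 ?_⟩
    rw [← hx, Ext.mk₀_comp_mk₀]
  · intro H
    refine subsingleton_of_forall_eq 0 fun x => ?_
    obtain ⟨y, rfl⟩ := Ext.contravariant_sequence_exact₃ h N x (Ext.eq_zero_of_projective _) (add_zero 1)
    obtain ⟨g, rfl⟩ := (Ext.mk₀_bijective _ _).2 y
    obtain ⟨k, rfl⟩ := H g
    rw [← Ext.mk₀_comp_mk₀]
    exact h.extClass_comp_assoc _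

theorem subsingleton_ext_succ_iff {S : ShortComplex (ModuleCat.{u} A)} (h : S.ShortExact)
    [Projective S.X₂] (N : ModuleCat.{u} A) (n : ℕ) :
    Subsingleton (Ext S.X₃ N (n + 2)) ↔ Subsingleton (Ext S.X₁ N (n + 1)) := by
  constructor
  · intro hs
    refine subsingleton_of_forall_eq 0 fun x => ?_
    obtain ⟨y, rfl⟩ := Ext.contravariant_sequence_exact₁ h N x (show 1 + (n + 1) = n + 2 by ring)
      (Subsingleton.elim _ _)
    rw [Ext.eq_zero_of_projective y, Ext.comp_zero]
  · intro hs
    refine subsingleton_of_forall_eq 0 fun x => ?_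
    obtain ⟨y, rfl⟩ := Ext.contravariant_sequence_exact₃ h N x (Ext.eq_zero_of_projective _)
      (show 1 + (n + 1) = n + 2 by ring)
    rw [Subsingleton.elim y 0, Ext.comp_zero]


theorem shortExact_of {K F M : Type u} [AddCommGroup K] [Module A K] [AddCommGroup F] [Module A F]
    [AddCommGroup M] [Module A M] {i : K →ₗ[A] F} {f : F →ₗ[A] M} (hi : Function.Injective i)
    (he : Function.Exact i f) (hf : Function.Surjective f) :
    (ModuleCat.shortComplexOfCompEqZero i f he.linearMap_comp_eq_zero).ShortExact :=
  ModuleCat.shortComplex_shortExact _ he hi hf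

theorem ext_one_iff {K F M : Type u} [AddCommGroup K] [Module A K] [AddCommGroup F] [Module A F]
    [AddCommGroup M] [Module A M] {i : K →ₗ[A] F} {f : F →ₗ[A] M} (hi : Function.Injective i)
    (he : Function.Exact i f) (hf : Function.Surjective f)
    [Module.Projective A F] (N : Type u) [AddCommGroup N] [Module A N] :
    Subsingleton (Ext (ModuleCat.of A M) (ModuleCat.of A N) 1) ↔
      ∀ g : K →ₗ[A] N, ∃ k : F →ₗ[A] N, k ∘ₗ i = g := by
  have : Projective (ModuleCat.of A F) := inferInstance
  refine (subsingleton_ext_one_iff (shortExact_of hi he hf) (ModuleCat.of A N)).trans ⟨?_, ?_⟩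
  · intro H g
    obtain ⟨k, hk⟩ := H (ModuleCat.ofHom g)
    exact ⟨k.hom, congrArg ModuleCat.Hom.hom hk⟩
  · intro H g
    obtain ⟨k, hk⟩ := H g.hom
    exact ⟨ModuleCat.ofHom k, ModuleCat.hom_ext hk⟩

theorem ext_succ_iff {K F M : Type u} [AddCommGroup K] [Module A K] [AddCommGroup F] [Module A F]
    [AddCommGroup M] [Module A M] {i : K →ₗ[A] F} {f : F →ₗ[A] M} (hi : Function.Injective i)
    (he : Function.Exact i f) (hf : Function.Surjective f)
    [Module.Projective A F] (N : Type u) [AddCommGroup N] [Module A N] (n : ℕ) :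
    Subsingleton (Ext (ModuleCat.of A M) (ModuleCat.of A N) (n + 2)) ↔
      Subsingleton (Ext (ModuleCat.of A K) (ModuleCat.of A N) (n + 1)) :=
  have : Projective (ModuleCat.of A F) := inferInstance
  subsingleton_ext_succ_iff (shortExact_of hi he hf) (ModuleCat.of A N) n

theorem ext_baseChange [IsNoetherianRing A] (B : Type u) [CommRing B] [Algebra A B]
    [Module.Flat A B] (N : Type u) [AddCommGroup N] [Module A N] (n : ℕ)
    (M : Type u) [AddCommGroup M] [Module A M] [Module.Finite A M]
    (h : Subsingleton (Ext (ModuleCat.of A M) (ModuleCat.of A N) (n + 1))) :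
    Subsingleton (Ext (ModuleCat.of B (B ⊗[A] M)) (ModuleCat.of B (B ⊗[A] N)) (n + 1)) := by
  induction n generalizing M with
  | zero =>
    obtain ⟨F, _, _, _, _, f, hf⟩ := Module.exists_finite_presentation A M
    have he : Function.Exact (LinearMap.ker f).subtype f := LinearMap.exact_subtype_ker_map f
    rw [ext_one_iff (Submodule.subtype_injective _) he hf] at h
    rw [zero_add, ext_one_iff (i := (LinearMap.ker f).subtype.baseChange B) (f := f.baseChange B)
      (Module.Flat.lTensor_preserves_injective_linearMap _ (Submodule.subtype_injective _))
      (lTensor_exact B he hf) (LinearMap.lTensor_surjective B hf)]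
    have : Module.FinitePresentation A (LinearMap.ker f) := Module.finitePresentation_of_finite _ _
    have hb := Module.FinitePresentation.isBaseChange_map A (LinearMap.ker f) N B
    intro g
    obtain ⟨g, rfl⟩ := hb.equiv.surjective g
    induction g using TensorProduct.induction_on with
    | zero => exact ⟨0, by simp⟩
    | add a b ha hb =>
      obtain ⟨k, hk⟩ := ha
      obtain ⟨l, hl⟩ := hb
      exact ⟨k + l, by rw [map_add, ← hk, ← hl, LinearMap.add_comp]⟩
    | tmul b g =>
      obtain ⟨k, rfl⟩ := h g
      refine ⟨b • k.baseChange B, ?_⟩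
      rw [IsBaseChange.equiv_tmul, LinearMap.smul_comp, ← LinearMap.baseChange_comp]
      rfl
  | succ n ih =>
    obtain ⟨F, _, _, _, _, f, hf⟩ := Module.exists_finite_presentation A M
    have he : Function.Exact (LinearMap.ker f).subtype f := LinearMap.exact_subtype_ker_map f
    rw [ext_succ_iff (Submodule.subtype_injective _) he hf] at h
    rw [ext_succ_iff (i := (LinearMap.ker f).subtype.baseChange B) (f := f.baseChange B)
      (Module.Flat.lTensor_preserves_injective_linearMap _ (Submodule.subtype_injective _))
      (lTensor_exact B he hf) (LinearMap.lTensor_surjective B hf)]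
    exact ih _ h
end

/-! ### The divisor class group -/

/-- A normal domain: a noetherian integrally closed integral domain. -/
class IsNormalDomain (A : Type u) [CommRing A] : Prop extends
  IsDomain A, IsNoetherianRing A, IsIntegrallyClosed A

/-- Finitely generated reflexive modules of rank one. -/
structure IsDivisorial (A : Type u) [CommRing A] (M : Type u) [AddCommGroup M] [Module A M] :
    Prop where
  finite : Module.Finite A M
  reflexive : Module.IsReflexive A M
  rank_eq_one : Module.rank A M = 1

theorem IsDivisorial.of_equiv {A : Type u} [CommRing A] {M N : Type u} [AddCommGroup M] [Module A M]
    [AddCommGroup N] [Module A N] (h : IsDivisorial A M) (e : M ≃ₗ[A] N) : IsDivisorial A N where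
  finite := have := h.finite; Module.Finite.equiv e
  reflexive := have := h.reflexive; Module.equiv e
  rank_eq_one := by rw [← e.rank_eq, h.rank_eq_one]

/-- The divisor class group of `A` as a set: the isomorphism classes of finitely generated reflexive
`A`-modules of rank one. -/
def Cl (A : Type u) [CommRing A] : Set (IsoClass A) :=
  {x | ∃ (M : Type u) (_ : AddCommGroup M) (_ : Module A M), IsDivisorial A M ∧ x = .mk A M}

theorem mk_mem_Cl {A : Type u} [CommRing A] {M : Type u} [AddCommGroup M] [Module A M] :
    IsoClass.mk A M ∈ Cl A ↔ IsDivisorial A M := by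
  refine ⟨?_, fun h => ⟨M, _, _, h, rfl⟩⟩
  rintro ⟨N, _, _, h, e⟩
  obtain ⟨e⟩ := IsoClass.mk_eq_mk_iff.1 e
  exact h.of_equiv e.symm

section ClassGroup
variable {A : Type u} [CommRing A] [IsNormalDomain A]

theorem IsDivisorial.dual {M : Type u} [AddCommGroup M] [Module A M] (h : IsDivisorial A M) :
    IsDivisorial A (Module.Dual A M) where
  finite := have := h.finite; inferInstance
  reflexive := have := h.finite; reflexive_dual A M
  rank_eq_one := by have := h.finite; rw [rank_dual, h.rank_eq_one]

theorem IsDivisorial.dual_dual_tensor {M N : Type u} [AddCommGroup M] [Module A M]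
    [AddCommGroup N] [Module A N] (h : IsDivisorial A M) (h' : IsDivisorial A N) :
    IsDivisorial A (Module.Dual A (Module.Dual A (M ⊗[A] N))) where
  finite := have := h.finite; have := h'.finite; inferInstance
  reflexive := have := h.finite; have := h'.finite; reflexive_dual A _
  rank_eq_one := by
    have := h.finite
    have := h'.finite
    rw [rank_dual, rank_dual, rank_tensor, h.rank_eq_one, h'.rank_eq_one, one_mul]

/-- `[M] + [N] = [(M ⊗ N)**]`. -/
instance : Add (Cl A) where
  add x y := ⟨(x.1.tensor y.1).dual.dual, by
    obtain ⟨_, M, _, _, h, rfl⟩ := x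
    obtain ⟨_, N, _, _, h', rfl⟩ := y
    exact mk_mem_Cl.2 (h.dual_dual_tensor h')⟩

/-- The identity of the divisor class group is `[A]`. -/
instance : Zero (Cl A) where
  zero := ⟨.mk A A, mk_mem_Cl.2 ⟨inferInstance, inferInstance, Module.rank_self A⟩⟩

/-- `-[M] = [Hom_A(M, A)]`. -/
instance : Neg (Cl A) where
  neg x := ⟨x.1.dual, by
    obtain ⟨_, M, _, _, h, rfl⟩ := x
    exact mk_mem_Cl.2 h.dual⟩

theorem Cl.coe_add (x y : Cl A) : (↑(x + y) : IsoClass A) = (x.1.tensor y.1).dual.dual := rfl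

theorem tensor_comm {R : Type u} [CommRing R] (x y : IsoClass R) : x.tensor y = y.tensor x := by
  induction x using IsoClass.ind with | h M =>
  induction y using IsoClass.ind with | h N =>
  exact IsoClass.mk_eq (TensorProduct.comm R M N)

theorem tensor_assoc {R : Type u} [CommRing R] (x y z : IsoClass R) :
    (x.tensor y).tensor z = x.tensor (y.tensor z) := by
  induction x using IsoClass.ind with | h M =>
  induction y using IsoClass.ind with | h N =>
  induction z using IsoClass.ind with | h P =>
  exact IsoClass.mk_eq (TensorProduct.assoc R M N P)

theorem one_tensor {R : Type u} [CommRing R] (x : IsoClass R) : (IsoClass.mk R R).tensor x = x := by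
  induction x using IsoClass.ind with | h M =>
  exact IsoClass.mk_eq (TensorProduct.lid R M)

theorem Cl.dual_dual (x : Cl A) : x.1.dual.dual = x.1 := by
  obtain ⟨_, M, _, _, h, rfl⟩ := x
  have := h.reflexive
  exact IsoClass.mk_eq (Module.evalEquiv A M).symm

theorem dual_tensor_dual_dual (x y z : Cl A) :
    ((x.1.tensor y.1).dual.dual.tensor z.1).dual = ((x.1.tensor y.1).tensor z.1).dual := by
  obtain ⟨_, M, _, _, h, rfl⟩ := x
  obtain ⟨_, N, _, _, h', rfl⟩ := y
  obtain ⟨_, P, _, _, h'', rfl⟩ := z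
  have := h.finite
  have := h'.finite
  exact IsoClass.mk_eq (dualTensorEquiv A (M ⊗[A] N) P)

theorem Cl.neg_add (x : Cl A) : -x + x = 0 := by
  obtain ⟨_, M, _, _, h, rfl⟩ := x
  have := h.finite
  have := h.reflexive
  refine Subtype.ext ?_
  have h1 : IsoClass.mk A (Module.Dual A (Module.Dual A M ⊗[A] M)) = IsoClass.mk A A := by
    refine IsoClass.mk_eq ?_
    exact (TensorProduct.comm A M _).dualMap ≪≫ₗ (TensorProduct.lift.equiv (.id A) M _ A).symm ≪≫ₗ
      (Module.evalEquiv A M).symm.congrRight ≪≫ₗ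
      (LinearEquiv.ofBijective _ (bijective_lsmul A M h.rank_eq_one)).symm
  have h2 : (IsoClass.mk A A).dual = IsoClass.mk A A :=
    IsoClass.mk_eq (LinearMap.ringLmapEquivSelf A A A)
  exact (congrArg IsoClass.dual h1).trans h2

instance : AddCommGroup (Cl A) where
  __ := AddGroup.ofLeftAxioms (G := Cl A)
    (fun x y z => Subtype.ext <| by
      rw [Cl.coe_add, Cl.coe_add, dual_tensor_dual_dual, Cl.coe_add, Cl.coe_add,
        tensor_comm x.1 (y.1.tensor z.1).dual.dual, dual_tensor_dual_dual,
        tensor_comm _ x.1, tensor_assoc])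
    (fun x => Subtype.ext <| by
      rw [Cl.coe_add]
      exact (congrArg (fun y => IsoClass.dual (IsoClass.dual y)) (one_tensor x.1)).trans
        (Cl.dual_dual x))
    Cl.neg_add
  add_comm x y := Subtype.ext <| by rw [Cl.coe_add, Cl.coe_add, tensor_comm]

theorem baseChange_tensor {R S : Type u} [CommRing R] [CommRing S] (φ : R →+* S)
    (x y : IsoClass R) :
    (x.tensor y).baseChange φ = (x.baseChange φ).tensor (y.baseChange φ) := by
  induction x using IsoClass.ind with | h M =>
  induction y using IsoClass.ind with | h N =>
  let _ := φ.toAlgebra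
  exact IsoClass.mk_eq (AlgebraTensorModule.distribBaseChange R S M N)

theorem exists_baseChange_dual {R S : Type u} [CommRing R] [IsNoetherianRing R] [CommRing S]
    [Algebra R S] [Module.Flat R S] (M : Type u) [AddCommGroup M] [Module R M] [Module.Finite R M] :
    Nonempty (S ⊗[R] Module.Dual R M ≃ₗ[S] Module.Dual S (S ⊗[R] M)) := by
  have := Module.finitePresentation_of_finite R M
  exact ⟨(Module.FinitePresentation.isBaseChange_map R M R S).equiv ≪≫ₗ
    (AlgebraTensorModule.rid R S S).congrRight⟩

theorem baseChange_mem_Cl {B : Type u} [CommRing B] [IsNormalDomain B] {φ : A →+* B} (hφ : φ.Flat)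
    {x : IsoClass A} (hx : x ∈ Cl A) : x.baseChange φ ∈ Cl B := by
  obtain ⟨M, _, _, h, rfl⟩ := hx
  let _ := φ.toAlgebra
  have : Module.Flat A B := hφ
  have := h.finite
  have := h.reflexive
  exact mk_mem_Cl.2 ⟨inferInstance, reflexive_baseChange A B M,
    (rank_baseChange_flat A B M).trans h.rank_eq_one⟩

theorem baseChange_dual {A : Type u} [CommRing A] [IsNoetherianRing A] {B : Type u} [CommRing B] {φ : A →+* B} (hφ : φ.Flat)
    (M : Type u) [AddCommGroup M] [Module A M] [Module.Finite A M] :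
    (IsoClass.mk A M).dual.baseChange φ = ((IsoClass.mk A M).baseChange φ).dual := by
  let _ := φ.toAlgebra
  have : Module.Flat A B := hφ
  obtain ⟨e⟩ := exists_baseChange_dual (R := A) (S := B) M
  exact IsoClass.mk_eq e

/-- For `φ : A → B` flat, the group homomorphism `Cl(φ) : [M] ↦ [B ⊗_A M]`. -/
def Cl.map {B : Type u} [CommRing B] [IsNormalDomain B] (φ : A →+* B) (hφ : φ.Flat) :
    Cl A →+ Cl B :=
  AddMonoidHom.mk' (fun x => ⟨x.1.baseChange φ, baseChange_mem_Cl hφ x.2⟩) fun x y =>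
    Subtype.ext <| by
      change (x.1.tensor y.1).dual.dual.baseChange φ =
        ((x.1.baseChange φ).tensor (y.1.baseChange φ)).dual.dual
      obtain ⟨_, M, iM, jM, h, rfl⟩ := x
      obtain ⟨_, N, iN, jN, h', rfl⟩ := y
      have := h.finite
      have := h'.finite
      rw [← baseChange_tensor]
      exact (baseChange_dual hφ (Module.Dual A (M ⊗[A] N))).trans
        (congrArg IsoClass.dual (baseChange_dual hφ (M ⊗[A] N)))

end ClassGroup

/-! ### Semidualizing modules -/

/-- A module `C` over a noetherian ring `R` is semidualizing if it is finitely generated,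
`Hom_R(C, C) ≅ R`, and `Ext^n_R(C, C) = 0` for all `n ≥ 1`. -/
structure IsSemidualizing (R : Type u) [CommRing R] (C : Type u) [AddCommGroup C] [Module R C] :
    Prop where
  finite : Module.Finite R C
  end_equiv : Nonempty ((C →ₗ[R] C) ≃ₗ[R] R)
  ext_vanish : ∀ n : ℕ, 1 ≤ n → Subsingleton (Ext (ModuleCat.of R C) (ModuleCat.of R C) n)

theorem IsSemidualizing.of_equiv {R : Type u} [CommRing R] {C C' : Type u} [AddCommGroup C]
    [Module R C] [AddCommGroup C'] [Module R C'] (h : IsSemidualizing R C) (e : C ≃ₗ[R] C') :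
    IsSemidualizing R C' where
  finite := have := h.finite; Module.Finite.equiv e
  end_equiv := h.end_equiv.map fun f => (e.conj).symm ≪≫ₗ f
  ext_vanish n hn := have := h.ext_vanish n hn; subsingleton_ext_of_iso e.toModuleIso e.toModuleIso n

/-- The set of isomorphism classes of semidualizing `R`-modules. -/
def S0 (R : Type u) [CommRing R] : Set (IsoClass R) :=
  {x | ∃ (C : Type u) (_ : AddCommGroup C) (_ : Module R C), IsSemidualizing R C ∧ x = .mk R C}

theorem mk_mem_S0 {R : Type u} [CommRing R] {C : Type u} [AddCommGroup C] [Module R C] :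
    IsoClass.mk R C ∈ S0 R ↔ IsSemidualizing R C := by
  refine ⟨?_, fun h => ⟨C, _, _, h, rfl⟩⟩
  rintro ⟨N, _, _, h, e⟩
  obtain ⟨e⟩ := IsoClass.mk_eq_mk_iff.1 e
  exact h.of_equiv e.symm

theorem IsSemidualizing.baseChange {R S : Type u} [CommRing R] [IsNoetherianRing R] [CommRing S]
    [Algebra R S] [Module.Flat R S] {C : Type u} [AddCommGroup C] [Module R C]
    (h : IsSemidualizing R C) : IsSemidualizing S (S ⊗[R] C) where
  finite := have := h.finite; inferInstance
  end_equiv := by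
    have := h.finite
    have := Module.finitePresentation_of_finite R C
    obtain ⟨e⟩ := h.end_equiv
    exact ⟨(Module.FinitePresentation.isBaseChange_map R C C S).equiv.symm ≪≫ₗ
      e.baseChange R S _ _ ≪≫ₗ AlgebraTensorModule.rid R S S⟩
  ext_vanish n hn := by
    obtain ⟨n, rfl⟩ := Nat.exists_eq_add_of_le' hn
    have := h.finite
    exact ext_baseChange S C n C (h.ext_vanish _ hn)

/-- For `φ : R → S` flat, the map `[C] ↦ [S ⊗_R C]` on classes of semidualizing modules. -/
def S0.map {R S : Type u} [CommRing R] [IsNoetherianRing R] [CommRing S] (φ : R →+* S)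
    (hφ : φ.Flat) (x : S0 R) : S0 S :=
  ⟨x.1.baseChange φ, by
    obtain ⟨_, C, _, _, h, rfl⟩ := x
    let _ := φ.toAlgebra
    have : Module.Flat R S := hφ
    exact mk_mem_S0.2 (h.baseChange (S := S))⟩

/-! ### Picard group action -/

section Pic
open CommRing (Pic)

variable {R : Type u} [CommRing R]

theorem ext_invertible_tensor [IsNoetherianRing R] (P : Type u) [AddCommGroup P] [Module R P]
    [Module.Invertible R P] (N : Type u) [AddCommGroup N] [Module R N] (n : ℕ)
    (M : Type u) [AddCommGroup M] [Module R M] [Module.Finite R M]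
    (h : Subsingleton (Ext (ModuleCat.of R M) (ModuleCat.of R N) (n + 1))) :
    Subsingleton (Ext (ModuleCat.of R (P ⊗[R] M)) (ModuleCat.of R (P ⊗[R] N)) (n + 1)) := by
  induction n generalizing M with
  | zero =>
    obtain ⟨F, _, _, _, _, f, hf⟩ := Module.exists_finite_presentation R M
    have he : Function.Exact (LinearMap.ker f).subtype f := LinearMap.exact_subtype_ker_map f
    rw [ext_one_iff (Submodule.subtype_injective _) he hf] at h
    rw [zero_add, ext_one_iff (i := (LinearMap.ker f).subtype.lTensor P) (f := f.lTensor P)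
      (Module.Flat.lTensor_preserves_injective_linearMap _ (Submodule.subtype_injective _))
      (lTensor_exact P he hf) (LinearMap.lTensor_surjective P hf)]
    intro g
    obtain ⟨g, rfl⟩ : ∃ g' : LinearMap.ker f →ₗ[R] N, g'.lTensor P = g := by
      let e := TensorProduct.comm R P _ ≪≫ₗ Module.Invertible.linearEquiv R P
      obtain ⟨g', hg'⟩ := (Module.Invertible.rTensorEquiv (LinearMap.ker f) N e).surjective
        ((TensorProduct.comm R P N).toLinearMap ∘ₗ g ∘ₗ (TensorProduct.comm R _ P).toLinearMap)
      refine ⟨g', ?_⟩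
      ext p k
      apply (TensorProduct.comm R P N).injective
      exact LinearMap.congr_fun hg' (k ⊗ₜ p)
    obtain ⟨k, rfl⟩ := h g
    exact ⟨k.lTensor P, (LinearMap.lTensor_comp P _ _).symm⟩
  | succ n ih =>
    obtain ⟨F, _, _, _, _, f, hf⟩ := Module.exists_finite_presentation R M
    have he : Function.Exact (LinearMap.ker f).subtype f := LinearMap.exact_subtype_ker_map f
    rw [ext_succ_iff (Submodule.subtype_injective _) he hf] at h
    rw [ext_succ_iff (i := (LinearMap.ker f).subtype.lTensor P) (f := f.lTensor P)
      (Module.Flat.lTensor_preserves_injective_linearMap _ (Submodule.subtype_injective _))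
      (lTensor_exact P he hf) (LinearMap.lTensor_surjective P hf)]
    exact ih _ h

theorem IsSemidualizing.invertible_tensor [IsNoetherianRing R] (P : Type u) [AddCommGroup P]
    [Module R P] [Module.Invertible R P] {C : Type u} [AddCommGroup C] [Module R C]
    (h : IsSemidualizing R C) : IsSemidualizing R (P ⊗[R] C) where
  finite := have := h.finite; inferInstance
  end_equiv := by
    obtain ⟨e⟩ := h.end_equiv
    exact ⟨(TensorProduct.comm R P C).conj ≪≫ₗ
      (Module.Invertible.rTensorEquiv C C
        (TensorProduct.comm R P _ ≪≫ₗ Module.Invertible.linearEquiv R P)).symm ≪≫ₗ e⟩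
  ext_vanish n hn := by
    obtain ⟨n, rfl⟩ := Nat.exists_eq_add_of_le' hn
    have := h.finite
    exact ext_invertible_tensor P C n C (h.ext_vanish _ hn)

theorem pic_mk_tensor {P : Type u} [AddCommGroup P] [Module R P] [Module.Invertible R P]
    (x : IsoClass R) : (IsoClass.mk R (Pic.mk R P)).tensor x = (IsoClass.mk R P).tensor x :=
  congrArg (·.tensor x) (IsoClass.mk_eq (Pic.mk.linearEquiv R P))

/-- The Picard group acts on the classes of semidualizing modules by `[P] • [C] = [P ⊗_R C]`. (The
group law of the Picard group is written multiplicatively.) -/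
instance [IsNoetherianRing R] : MulAction (Pic R) (S0 R) where
  smul P x := ⟨(IsoClass.mk R P).tensor x.1, by
    obtain ⟨_, C, _, _, h, rfl⟩ := x
    exact mk_mem_S0.2 (h.invertible_tensor P)⟩
  one_smul x := Subtype.ext <| by
    change (IsoClass.mk R (1 : Pic R)).tensor x.1 = x.1
    rw [← Pic.mk_self, pic_mk_tensor, one_tensor]
  mul_smul P Q x := Subtype.ext <| by
    change (IsoClass.mk R (P * Q : Pic R)).tensor x.1 =
      (IsoClass.mk R P).tensor ((IsoClass.mk R Q).tensor x.1)
    rw [← tensor_assoc, Pic.mul_eq_tensor, pic_mk_tensor]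
    rfl

theorem coe_smul [IsNoetherianRing R] (P : Pic R) (x : S0 R) :
    (↑(P • x) : IsoClass R) = (IsoClass.mk R P).tensor x.1 := rfl

/-- The orbit space of `S0 R` under the action of the Picard group. -/
def SBar (R : Type u) [CommRing R] [IsNoetherianRing R] : Type (u + 1) :=
  MulAction.orbitRel.Quotient (Pic R) (S0 R)

/-- The projection of `S0 R` onto the orbit space. -/
def SBar.mk [IsNoetherianRing R] (x : S0 R) : SBar R :=
  Quotient.mk (MulAction.orbitRel (Pic R) (S0 R)) x

theorem SBar.mk_eq_mk_iff [IsNoetherianRing R] {x y : S0 R} :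
    SBar.mk x = SBar.mk y ↔ ∃ P : Pic R, y = P • x := by
  rw [eq_comm]
  refine Quotient.eq.trans (MulAction.orbitRel_apply.trans ⟨?_, ?_⟩)
  · rintro ⟨P, h⟩; exact ⟨P, h.symm⟩
  · rintro ⟨P, h⟩; exact ⟨P, h.symm⟩

/-- For `φ : R → S` flat, the map induced by `S0.map φ` on orbit spaces. -/
def SBar.map {S : Type u} [IsNoetherianRing R] [CommRing S] [IsNoetherianRing S] (φ : R →+* S)
    (hφ : φ.Flat) : SBar R → SBar S :=
  Quotient.lift (fun x => SBar.mk (S0.map φ hφ x)) fun y x h => by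
    obtain ⟨P, rfl⟩ := h
    let _ := φ.toAlgebra
    refine (SBar.mk_eq_mk_iff.2 ⟨Pic.mk S (S ⊗[R] P), Subtype.ext ?_⟩).symm
    rw [coe_smul, pic_mk_tensor]
    exact baseChange_tensor φ (IsoClass.mk R P) x.1

end Pic

/-! ### The maps attached to a tensor product of algebras -/

section TensorProductMaps
open CommRing (Pic)

variable {D R₁ R₂ : Type u} [CommRing D] [CommRing R₁] [CommRing R₂] [Algebra D R₁] [Algebra D R₂]

theorem extTensor_tensor (x x' : IsoClass R₁) (y y' : IsoClass R₂) :
    IsoClass.extTensor (D := D) (x.tensor x') (y.tensor y') =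
      (IsoClass.extTensor (D := D) x y).tensor (IsoClass.extTensor (D := D) x' y') := by
  induction x using IsoClass.ind with | h P₁ =>
  induction x' using IsoClass.ind with | h M₁ =>
  induction y using IsoClass.ind with | h P₂ =>
  induction y' using IsoClass.ind with | h M₂ =>
  let _ := Module.compHom P₁ (algebraMap D R₁)
  let _ := Module.compHom M₁ (algebraMap D R₁)
  let _ := Module.compHom P₂ (algebraMap D R₂)
  let _ := Module.compHom M₂ (algebraMap D R₂)
  have : IsScalarTower D R₁ P₁ := .of_algebraMap_smul fun _ _ => rfl
  have : IsScalarTower D R₁ M₁ := .of_algebraMap_smul fun _ _ => rfl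
  have : IsScalarTower D R₂ P₂ := .of_algebraMap_smul fun _ _ => rfl
  have : IsScalarTower D R₂ M₂ := .of_algebraMap_smul fun _ _ => rfl
  rw [IsoClass.extTensor_mk, IsoClass.extTensor_mk]
  refine (IsoClass.extTensor_mk (D := D) (P₁ ⊗[R₁] M₁) (P₂ ⊗[R₂] M₂)).trans ?_
  exact IsoClass.mk_eq (ExtTensor.interchange P₁ P₂ M₁ M₂)

theorem extTensor_self : IsoClass.extTensor (D := D) (.mk R₁ R₁) (.mk R₂ R₂) =
    .mk (R₁ ⊗[D] R₂) (R₁ ⊗[D] R₂) := by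
  rw [IsoClass.extTensor_mk]
  exact IsoClass.mk_eq
    { (LinearEquiv.refl D (R₁ ⊗[D] R₂)) with
      map_smul' := ExtTensor.linear_of_pure (D := D) (M₁ := R₁) (M₂ := R₂)
        (AddMonoidHom.id (R₁ ⊗[D] R₂)) fun _ _ _ _ =>
          (Algebra.TensorProduct.tmul_mul_tmul _ _ _ _).symm }

theorem exists_pic_extTensor (P₁ : Pic R₁) (P₂ : Pic R₂) :
    ∃ Q : Pic (R₁ ⊗[D] R₂), IsoClass.mk _ Q = IsoClass.extTensor (D := D) (.mk R₁ P₁) (.mk R₂ P₂) := by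
  let _ := Module.compHom P₁ (algebraMap D R₁)
  let _ := Module.compHom P₂ (algebraMap D R₂)
  have : IsScalarTower D R₁ P₁ := .of_algebraMap_smul fun _ _ => rfl
  have : IsScalarTower D R₂ P₂ := .of_algebraMap_smul fun _ _ => rfl
  have key : (IsoClass.extTensor (D := D) (.mk R₁ (P₁⁻¹ : Pic R₁)) (.mk R₂ (P₂⁻¹ : Pic R₂))).tensor
      (IsoClass.extTensor (D := D) (.mk R₁ P₁) (.mk R₂ P₂)) =
      .mk (R₁ ⊗[D] R₂) (R₁ ⊗[D] R₂) := by
    have h {R : Type u} [CommRing R] (P : Pic R) :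
        (IsoClass.mk R (P⁻¹ : Pic R)).tensor (.mk R P) = .mk R R := by
      refine Eq.trans (IsoClass.mk_eq (Pic.mk.linearEquiv R _).symm) ?_
      rw [← Pic.mul_eq_tensor, inv_mul_cancel, ← Pic.mk_self]
      exact IsoClass.mk_eq (Pic.mk.linearEquiv R R)
    rw [← extTensor_tensor, h, h, extTensor_self]
  rw [IsoClass.extTensor_mk (D := D) P₁ P₂] at key ⊢
  generalize IsoClass.extTensor (D := D) (.mk R₁ (P₁⁻¹ : Pic R₁)) (.mk R₂ (P₂⁻¹ : Pic R₂)) = y at key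
  induction y using IsoClass.ind with | h N =>
  obtain ⟨e⟩ := IsoClass.mk_eq_mk_iff.1 key
  have := Module.Invertible.right e
  exact ⟨Pic.mk _ (ExtTensor D P₁ P₂), IsoClass.mk_eq (Pic.mk.linearEquiv _ _)⟩

variable (D R₁ R₂) in
/-- `C₁ ⊗_D C₂` is semidualizing over `R₁ ⊗_D R₂` whenever each `Cᵢ` is semidualizing over `Rᵢ`. -/
def TensorPreservesS0 : Prop :=
  ∀ x ∈ S0 R₁, ∀ y ∈ S0 R₂, IsoClass.extTensor (D := D) x y ∈ S0 (R₁ ⊗[D] R₂)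

/-- The map `([C₁], [C₂]) ↦ [C₁ ⊗_D C₂]`, defined once `C₁ ⊗_D C₂` is known to be semidualizing. -/
def S0.tensor (h : TensorPreservesS0 D R₁ R₂) (p : S0 R₁ × S0 R₂) : S0 (R₁ ⊗[D] R₂) :=
  ⟨IsoClass.extTensor (D := D) p.1.1 p.2.1, h _ p.1.2 _ p.2.2⟩

/-- The map of orbit spaces induced by `S0.tensor`. -/
def SBar.tensor [IsNoetherianRing R₁] [IsNoetherianRing R₂] [IsNoetherianRing (R₁ ⊗[D] R₂)]
    (h : TensorPreservesS0 D R₁ R₂) (p : SBar R₁ × SBar R₂) : SBar (R₁ ⊗[D] R₂) :=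
  Quotient.lift₂ (fun x y => SBar.mk (S0.tensor h (x, y))) (fun x y x' y' hx hy => by
    obtain ⟨P₁, rfl⟩ := hx
    obtain ⟨P₂, rfl⟩ := hy
    obtain ⟨Q, hQ⟩ := exists_pic_extTensor (D := D) P₁ P₂
    refine (SBar.mk_eq_mk_iff.2 ⟨Q, Subtype.ext ?_⟩).symm
    rw [coe_smul, hQ]
    exact extTensor_tensor (D := D) (.mk R₁ P₁) _ (.mk R₂ P₂) _) p.1 p.2

variable (D R₁ R₂) in
/-- The natural ring homomorphism `R₁ → R₁ ⊗_D R₂`. -/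
abbrev leftMap : R₁ →+* R₁ ⊗[D] R₂ := Algebra.TensorProduct.includeLeftRingHom

variable (D R₁ R₂) in
/-- The natural ring homomorphism `R₂ → R₁ ⊗_D R₂`. -/
abbrev rightMap : R₂ →+* R₁ ⊗[D] R₂ :=
  (Algebra.TensorProduct.includeRight : R₂ →ₐ[D] R₁ ⊗[D] R₂).toRingHom

variable [IsDomain D] [IsPrincipalIdealRing D]

theorem flat_of_injective {R : Type u} [CommRing R] [IsDomain R] [Algebra D R]
    (h : Function.Injective (algebraMap D R)) : Module.Flat D R := by
  have : FaithfulSMul D R := (faithfulSMul_iff_algebraMap_injective D R).2 h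
  have : Module.IsTorsionFree D R := inferInstance
  infer_instance

theorem flat_leftMap [IsDomain R₂] (h : Function.Injective (algebraMap D R₂)) :
    (leftMap D R₁ R₂).Flat := by
  have := flat_of_injective h
  have : Module.Flat R₁ (R₁ ⊗[D] R₂) := inferInstance
  exact RingHom.flat_algebraMap_iff.2 this

theorem flat_rightMap [IsDomain R₁] (h : Function.Injective (algebraMap D R₁)) :
    (rightMap D R₁ R₂).Flat := by
  have e : rightMap D R₁ R₂ =
      (Algebra.TensorProduct.comm D R₂ R₁).toRingEquiv.toRingHom.comp
        Algebra.TensorProduct.includeLeftRingHom := by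
    ext x; simp
  rw [e]
  exact (flat_leftMap h).comp (.of_bijective (Algebra.TensorProduct.comm D R₂ R₁).bijective)

end TensorProductMaps

end SDM

end

open SDM

/-!
The content lies in three facts: `S0 A ⊆ Cl A`, the stability of semidualizing modules under `⊗_D`
(which together make the maps well defined), and the commutativity of the square for
`Cl(g₁) + Cl(g₂)`. The other five squares commute by definition of the maps.

*Semidualizing modules over a normal domain `A` are divisorial.* Let `C` be semidualizing. An
isomorphism `End(C) ≅ A` forces every endomorphism to be a homothety
(`bijective_lsmul_of_end_equiv`), and over the fraction field it gives `(rank C)² = 1`. As `C` is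
faithful, it maps nontrivially to `A ⧸ p` for every prime `p` (`exists_ne_zero_hom_quotient`).
For `p` an associated prime of `C` this produces an endomorphism killed by `p`, so `p = 0` and `C` is
torsion-free. For `p` an associated prime of `C** ⧸ C` and a suitable `0 ≠ a ∈ p` it produces a
nonzero map `C → C ⧸ a C` killed by `p`; it lifts to `C` because `Ext¹(C, C) = 0`, so it is
multiplication by some `b ∉ a A` with `p b ⊆ a A`. All maps `C → A` take values in `p`, so `b / a`
preserves `C*`, which contradicts `End(C*) = A` (`IsSemidualizing.isReflexive`).

*Tensor products.* Semidualizing modules are torsion-free, hence flat over the principal ideal domain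
`D`, and so is `Hom(M₂, N₂)` whenever `N₂` is. Therefore every map `M₁ ⊗_D M₂ → N₁ ⊗_D N₂` over
`T = R₁ ⊗_D R₂` is a sum of maps `f ⊗ g` (`ExtTensor.mem_closure_map`). This yields
`End_T(C₁ ⊗ C₂) = T`, and it also yields the extension property that expresses the vanishing of `Ext¹`
in terms of a first syzygy. Dimension shifting, in one factor after the other, then gives the
vanishing of all higher Ext groups (`subsingleton_ext_extTensor`).

*The square for `Cl(g₁) + Cl(g₂)`.* The tensor product over `T` of the base changes of `C₁` and `C₂`
is `C₁ ⊗_D C₂`. Being semidualizing over `T`, it is reflexive, so the double dual in the group law of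
`Cl T` does not change it.
-/

noncomputable section

namespace SDM

/-! ### Semidualizing modules over a normal domain are divisorial -/

section Divisorial

/-- The idea: if `End_R(M)` is generated by `ψ` and `1 = w ψ`, then `ψ ∘ ψ = v ψ` forces
`w² v = w`, so `w` is a unit and `1` is a generator as well. -/
theorem bijective_lsmul_of_end_equiv {R : Type u} [CommRing R] [IsDomain R] {M : Type u}
    [AddCommGroup M] [Module R M] (e : (M →ₗ[R] M) ≃ₗ[R] R) :
    Function.Bijective (LinearMap.lsmul R M) := by
  set ψ := e.symm 1 with hψ
  have gen (φ : M →ₗ[R] M) : φ = e φ • ψ := by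
    apply e.injective; rw [map_smul, hψ, e.apply_symm_apply, smul_eq_mul, mul_one]
  set w := e LinearMap.id with hw
  have hid : (LinearMap.id : M →ₗ[R] M) = w • ψ := gen _
  have hw0 : w ≠ 0 := by
    intro h0
    rw [h0, zero_smul] at hid
    have h1 : ψ = 0 := by rw [← LinearMap.id_comp ψ, hid, LinearMap.zero_comp]
    have h2 := congrArg e h1
    rw [hψ, e.apply_symm_apply, map_zero] at h2
    exact one_ne_zero h2
  set v := e (ψ ∘ₗ ψ) with hv
  have hcomp : ψ ∘ₗ ψ = v • ψ := gen _
  have h1 : w * w * v = w := by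
    have : (w • ψ) ∘ₗ (w • ψ) = w • ψ := by rw [← hid]; rfl
    rw [LinearMap.smul_comp, LinearMap.comp_smul, hcomp, smul_smul, smul_smul] at this
    have := congrArg e this
    simp only [map_smul, hψ, e.apply_symm_apply, smul_eq_mul, mul_one] at this
    linear_combination this
  have h2 : w * v = 1 := mul_left_cancel₀ hw0 (by linear_combination h1)
  have hψ' : ψ = v • LinearMap.id := by rw [hid, smul_smul, mul_comm v w, h2, one_smul]
  constructor
  · intro a b hab
    have h3 : a • (LinearMap.id : M →ₗ[R] M) = b • LinearMap.id := hab
    have := congrArg e h3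
    rw [map_smul, map_smul] at this
    exact mul_right_cancel₀ hw0 this
  · intro φ
    refine ⟨e φ * v, ?_⟩
    change (e φ * v) • LinearMap.id = φ
    rw [mul_smul, ← hψ', ← gen]

/-- A finitely generated faithful module has full support: it maps nontrivially onto a submodule of
the residue domain at every prime. Otherwise `M ⧸ p M` is torsion over `A ⧸ p`, so `s M ⊆ p M` for
some `s ∉ p`, and the determinant trick gives `s ^ n ∈ p`. -/
theorem exists_ne_zero_hom_quotient {A : Type u} [CommRing A] [IsNoetherianRing A] {M : Type u}
    [AddCommGroup M] [Module A M] [Module.Finite A M]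
    (hM : Function.Injective (LinearMap.lsmul A M)) (p : Ideal A) [p.IsPrime] :
    ∃ f : M →ₗ[A] A ⧸ p, f ≠ 0 := by
  classical
  by_contra! H
  let Q := M ⧸ (p • ⊤ : Submodule A M)
  have : Module.Finite (A ⧸ p) Q := Module.Finite.of_restrictScalars_finite A _ _
  have hrank : Module.rank (A ⧸ p) Q = 0 := by
    rw [← rank_dual (A ⧸ p) Q]
    have : Subsingleton (Module.Dual (A ⧸ p) Q) := by
      refine subsingleton_of_forall_eq 0 fun f => LinearMap.ext fun m => ?_
      obtain ⟨m, rfl⟩ := Submodule.mkQ_surjective _ m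
      exact LinearMap.congr_fun (H ((f.restrictScalars A) ∘ₗ
        Submodule.mkQ (p • ⊤ : Submodule A M))) m
    exact rank_subsingleton' _ _
  rw [Module.rank_eq_zero_iff_isTorsion] at hrank
  obtain ⟨s, hs, hsM⟩ : ∃ s : A, s ∉ p ∧ ∀ m : M, s • m ∈ (p • ⊤ : Submodule A M) := by
    obtain ⟨T, hT⟩ := (Module.Finite.fg_top : (⊤ : Submodule A M).FG)
    have h1 (m : M) : ∃ s : A, s ∉ p ∧ s • m ∈ (p • ⊤ : Submodule A M) := by
      obtain ⟨⟨t, ht⟩, h⟩ := @hrank (Submodule.Quotient.mk m)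
      obtain ⟨s, rfl⟩ := Ideal.Quotient.mk_surjective t
      refine ⟨s, fun hsp => nonZeroDivisors.ne_zero ht (Ideal.Quotient.eq_zero_iff_mem.2 hsp), ?_⟩
      exact (Submodule.Quotient.mk_eq_zero _).1 h
    choose σ hσ hσ' using h1
    refine ⟨∏ m ∈ T, σ m, ?_, fun m => ?_⟩
    · rw [Ideal.IsPrime.prod_mem_iff]
      rintro ⟨m, -, h⟩
      exact hσ m h
    · have hm : m ∈ Submodule.span A (T : Set M) := hT ▸ Submodule.mem_top
      induction hm using Submodule.span_induction with
      | zero => rw [smul_zero]; exact zero_mem _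
      | add x y _ _ hx hy => rw [smul_add]; exact add_mem hx hy
      | smul a x _ hx => rw [smul_comm]; exact Submodule.smul_mem _ _ hx
      | mem x hx =>
        rw [← Finset.prod_erase_mul T σ hx, mul_smul]
        exact Submodule.smul_mem _ _ (hσ' x)
  obtain ⟨q, hq, -, hqc, hq0⟩ :=
    LinearMap.exists_monic_and_natDegree_eq_and_coeff_mem_pow_and_aeval_eq_zero A
      (LinearMap.lsmul A M s) p (by rintro _ ⟨m, rfl⟩; exact hsM m)
  have h2 : q.eval s = 0 := by
    apply hM
    rw [map_zero, ← hq0]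
    ext m
    have := Polynomial.aeval_algHom_apply (Algebra.lsmul A A M) s q
    rw [Polynomial.coe_aeval_eq_eval] at this
    exact (LinearMap.congr_fun this m).symm
  have h3 : s ^ q.natDegree ∈ p := by
    rw [Polynomial.eval_eq_sum_range, Finset.sum_range_succ, hq.coeff_natDegree, one_mul] at h2
    rw [eq_neg_of_add_eq_zero_right h2]
    refine neg_mem (sum_mem fun i hi => Ideal.mul_mem_right _ _ ?_)
    have hlt : i < q.natDegree := Finset.mem_range.1 hi
    exact Ideal.pow_le_self (Nat.sub_ne_zero_of_lt hlt) (hqc i)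
  exact hs (Ideal.IsPrime.mem_of_pow_mem ‹_› _ h3)

variable {A : Type u} [CommRing A] {C : Type u} [AddCommGroup C] [Module A C]

theorem IsSemidualizing.rank_eq_one [IsDomain A] [IsNoetherianRing A] (h : IsSemidualizing A C) :
    Module.rank A C = 1 := by
  let K := FractionRing A
  obtain ⟨e⟩ := (h.baseChange (S := K)).end_equiv
  have := h.finite
  have h1 := e.finrank_eq
  rw [Module.finrank_linearMap, Module.finrank_self] at h1
  have h2 : Module.finrank K (K ⊗[A] C) = 1 := Nat.eq_one_of_mul_eq_one_left h1
  rw [← rank_baseChange_flat A K C, ← Module.finrank_eq_rank, h2, Nat.cast_one]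

/-- A torsion element yields an associated prime `p ≠ 0`; a nonzero composite `C → A ⧸ p → C` is
then killed by `p`, which is impossible in `End(C) ≅ A`. -/
theorem IsSemidualizing.isTorsionFree [IsDomain A] [IsNoetherianRing A]
    (h : IsSemidualizing A C) : Module.IsTorsionFree A C := by
  have := h.finite
  obtain ⟨e⟩ := h.end_equiv
  have hb := bijective_lsmul_of_end_equiv e
  have key : ∀ (a : A) (x : C), a • x = 0 → a = 0 ∨ x = 0 := by
    intro a x hax
    by_contra! hne
    obtain ⟨p, hp, hle⟩ := exists_le_isAssociatedPrime_of_isNoetherianRing A x hne.2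
    have hap : a ∈ p := hle (by rwa [Submodule.mem_colon_singleton])
    obtain ⟨hp, g, hg⟩ := (isAssociatedPrime_iff_exists_injective_linearMap p C).1 hp
    obtain ⟨f, hf⟩ := exists_ne_zero_hom_quotient hb.1 p
    have h0 : a • (g ∘ₗ f) = 0 := by
      rw [← LinearMap.comp_smul]
      have : a • f = 0 := by
        ext m
        obtain ⟨b, hb⟩ := Ideal.Quotient.mk_surjective (f m)
        rw [LinearMap.smul_apply, ← hb]
        exact Ideal.Quotient.eq_zero_iff_mem.2 (Ideal.mul_mem_right _ _ hap)
      rw [this, LinearMap.comp_zero]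
    have h1 : g ∘ₗ f = 0 := by
      apply e.injective
      have := congrArg e h0
      rw [map_smul, map_zero, smul_eq_mul] at this
      rw [map_zero]
      exact (mul_eq_zero.1 this).resolve_left hne.1
    exact hf (LinearMap.ext fun m => hg (by
      simpa using LinearMap.congr_fun h1 m))
  exact Module.isTorsionFree_iff_smul_eq_zero.2 fun {a} {x} => key a x

/-- For an exact sequence `0 → C → N → P → 0` with `Ext¹(M, C) = 0`, maps `M → P` lift to `N`. -/
theorem exists_lift_of_ext_one (M : Type u) {N P : Type u} [AddCommGroup M] [Module A M]
    [AddCommGroup N] [Module A N] [AddCommGroup P] [Module A P]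
    (h : Subsingleton (Ext (ModuleCat.of A M) (ModuleCat.of A C) 1)) {i : C →ₗ[A] N} {f : N →ₗ[A] P}
    (hi : Function.Injective i) (he : Function.Exact i f) (hf : Function.Surjective f)
    (g : M →ₗ[A] P) : ∃ k : M →ₗ[A] N, f ∘ₗ k = g := by
  obtain ⟨x, hx⟩ := Ext.covariant_sequence_exact₃ (ModuleCat.of A M) (shortExact_of hi he hf)
    (Ext.mk₀ (ModuleCat.ofHom g)) (zero_add 1)
    (Subsingleton.elim (α := Ext _ (ModuleCat.of A C) 1) _ _)
  obtain ⟨k, rfl⟩ := (Ext.mk₀_bijective _ _).2 x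
  refine ⟨k.hom, ?_⟩
  rw [Ext.mk₀_comp_mk₀] at hx
  exact congrArg ModuleCat.Hom.hom ((Ext.mk₀_bijective _ _).1 hx)

/-- Division of a homomorphism by an element `a` regular on the target. -/
theorem exists_smul_eq {M N : Type u} [AddCommGroup M] [Module A M] [AddCommGroup N] [Module A N]
    {a : A} (ha : Function.Injective (LinearMap.lsmul A N a)) (φ : M →ₗ[A] N)
    (h : ∀ m, ∃ n, a • n = φ m) : ∃ ψ : M →ₗ[A] N, a • ψ = φ := by
  refine ⟨(LinearEquiv.ofInjective _ ha).symm.toLinearMap ∘ₗ φ.codRestrict _ h, ?_⟩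
  ext m
  exact congrArg Subtype.val ((LinearEquiv.ofInjective _ ha).apply_symm_apply ⟨φ m, h m⟩)

theorem exists_relation_of_rank_eq_one [IsDomain A] (hr : Module.rank A C = 1) (c d : C) :
    ∃ s t : A, s • c + t • d = 0 ∧ ¬ (s = 0 ∧ t = 0) := by
  by_contra! H
  have hl : LinearIndependent A ![c, d] := LinearIndependent.pair_iff.2 H
  have := hl.cardinal_lift_le_rank
  rw [hr, Cardinal.mk_fin, Cardinal.lift_natCast, Cardinal.lift_one] at this
  exact absurd this (by norm_num)

/-- Any two forms on a module of rank one are proportional. -/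
theorem dual_mul_dual_comm [IsDomain A] (hr : Module.rank A C = 1) (f g : Module.Dual A C)
    (c d : C) : f c * g d = g c * f d := by
  obtain ⟨s, t, h, hst⟩ := exists_relation_of_rank_eq_one hr c d
  have hf := congrArg f h
  have hg := congrArg g h
  simp only [map_add, map_smul, smul_eq_mul, map_zero] at hf hg
  have h1 : s * (f c * g d - g c * f d) = 0 := by linear_combination g d * hf - f d * hg
  have h2 : t * (f c * g d - g c * f d) = 0 := by linear_combination f c * hg - g c * hf
  by_contra hne
  exact hst ⟨(mul_eq_zero.1 h1).resolve_right (sub_ne_zero.2 hne),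
    (mul_eq_zero.1 h2).resolve_right (sub_ne_zero.2 hne)⟩

/-- Suppose `C → C**` is not onto and let `p` be the annihilator of the class of some `x ∈ C**`,
an associated prime of the cokernel. In rank one `g(c) x = x(g) c` for `g ∈ C*` and `c ∈ C`, so `p`
contains all values `g(c)`. Fix such a value `a ≠ 0`. The class of `a x` in `C ⧸ a C` has annihilator
`p`, which gives a nonzero map `C → A ⧸ p → C ⧸ a C`; as `Ext¹(C, C) = 0` and `End(C) ≅ A`, it is
induced by multiplication by some `b ∉ a A` with `p b ⊆ a A`. Hence multiplication by `b / a`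
preserves `C*`, and since `End(C*) = A` this means `b ∈ a A`, a contradiction. -/
theorem IsSemidualizing.isReflexive [IsNormalDomain A] (h : IsSemidualizing A C) :
    Module.IsReflexive A C := by
  have := h.finite
  have htf := h.isTorsionFree
  have hr := h.rank_eq_one
  obtain ⟨e⟩ := h.end_equiv
  have hb := bijective_lsmul_of_end_equiv e
  have hrd : Module.rank A (Module.Dual A C) = 1 := (rank_dual A C).trans hr
  have hrefl := reflexive_dual A C
  obtain ⟨f, hf⟩ : ∃ f : Module.Dual A C, f ≠ 0 := by
    by_contra! H
    have : Subsingleton (Module.Dual A C) := subsingleton_of_forall_eq 0 H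
    rw [rank_subsingleton'] at hrd
    exact zero_ne_one hrd
  obtain ⟨c₀, hc₀⟩ : ∃ c₀, f c₀ ≠ 0 := by
    by_contra! H
    exact hf (LinearMap.ext H)
  have inj {N : Type u} [AddCommGroup N] [Module A N] [Module.IsTorsionFree A N] {a : A}
      (ha : a ≠ 0) : Function.Injective (LinearMap.lsmul A N a) := smul_right_injective N ha
  have hfinj : ∀ c, f c = 0 → c = 0 := by
    intro c hc
    obtain ⟨s, t, h1, h2⟩ := exists_relation_of_rank_eq_one hr c c₀
    have h3 := congrArg f h1
    rw [map_add, map_smul, map_smul, hc, smul_zero, zero_add, map_zero, smul_eq_mul] at h3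
    have ht := (mul_eq_zero.1 h3).resolve_right hc₀
    rw [ht, zero_smul, add_zero] at h1
    exact (smul_eq_zero.1 h1).resolve_left fun hs => h2 ⟨hs, ht⟩
  set ev := Module.Dual.eval A C with hev
  have hevinj : Function.Injective ev := by
    rw [injective_iff_map_eq_zero]
    exact fun c hc => hfinj c (LinearMap.congr_fun hc f)
  refine ⟨hevinj, LinearMap.range_eq_top.1 ?_⟩
  by_contra hne
  obtain ⟨p, x, hp, hpx⟩ : ∃ (p : Ideal A) (x : Module.Dual A (Module.Dual A C)), p.IsPrime ∧
      ∀ r, r ∈ p ↔ ∃ c, ev c = r • x := by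
    have : Nontrivial (Module.Dual A (Module.Dual A C) ⧸ LinearMap.range ev) :=
      Submodule.Quotient.nontrivial_iff.2 hne
    obtain ⟨p, hp⟩ := associatedPrimes.nonempty A
      (Module.Dual A (Module.Dual A C) ⧸ LinearMap.range ev)
    obtain ⟨hp, x, hx⟩ := isAssociatedPrime_iff.1 hp
    obtain ⟨x, rfl⟩ := Submodule.Quotient.mk_surjective _ x
    refine ⟨p, x, hp, fun r => ?_⟩
    rw [hx, Submodule.mem_colon_singleton, ← Submodule.Quotient.mk_smul, Submodule.mem_bot,
      Submodule.Quotient.mk_eq_zero, LinearMap.mem_range]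
  -- `g c • x = x g • ev c`, as both sides take the value `g c * x k = x g * k c` at `k`.
  have hmem (g : Module.Dual A C) (c : C) : g c ∈ p := by
    refine (hpx _).2 ⟨x g • c, ?_⟩
    ext k
    have h1 : g c • k = k c • g := LinearMap.ext fun d => dual_mul_dual_comm hr g k c d
    have h2 := congrArg x h1
    rw [map_smul, map_smul, smul_eq_mul, smul_eq_mul] at h2
    rw [map_smul, LinearMap.smul_apply, LinearMap.smul_apply, smul_eq_mul, smul_eq_mul, h2,
      mul_comm]
    rfl
  set a := f c₀ with ha
  obtain ⟨c', hc'⟩ := (hpx a).1 (hmem f c₀)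
  let q := (LinearMap.range (LinearMap.lsmul A C a)).mkQ
  let j := LinearMap.toSpanSingleton A _ (q c')
  have hker (r : A) : r ∈ p ↔ j r = 0 := by
    rw [hpx, LinearMap.toSpanSingleton_apply, ← map_smul, Submodule.mkQ_apply,
      Submodule.Quotient.mk_eq_zero, LinearMap.mem_range]
    refine exists_congr fun c => ?_
    rw [← hevinj.eq_iff, LinearMap.lsmul_apply, map_smul, map_smul, hc', smul_comm r a]
    exact (inj (N := Module.Dual A (Module.Dual A C)) hc₀).eq_iff.symm
  let j' : (A ⧸ p) →ₗ[A] _ := Submodule.liftQ p j fun r hr => (hker r).1 hr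
  have hj' : Function.Injective j' := by
    rw [← LinearMap.ker_eq_bot]
    exact Submodule.ker_liftQ_eq_bot' _ _ (by ext r; exact hker r)
  obtain ⟨f₀, hf₀⟩ := exists_ne_zero_hom_quotient hb.1 p
  obtain ⟨k, hk⟩ := exists_lift_of_ext_one (C := C) C (h.ext_vanish 1 le_rfl)
    (i := LinearMap.lsmul A C a) (f := q) (inj hc₀)
    (fun y => by rw [Submodule.mkQ_apply, Submodule.Quotient.mk_eq_zero]; rfl)
    (Submodule.mkQ_surjective _) (j' ∘ₗ f₀)
  obtain ⟨b, rfl⟩ := hb.2 k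
  -- Multiplication by `b r` maps `C` into `a C`; divided by `a` it is again a homothety.
  have hpb (r : A) (hrp : r ∈ p) : ∃ t, a * t = b * r := by
    obtain ⟨ψ, hψ⟩ := exists_smul_eq (inj hc₀) (LinearMap.lsmul A C (b * r)) fun c => by
      have h1 := congrArg (r • ·) (LinearMap.congr_fun hk c)
      have h2 : r • j' (f₀ c) = 0 := by
        obtain ⟨s, hs⟩ := Ideal.Quotient.mk_surjective (f₀ c)
        rw [← map_smul, ← hs]
        have : r • (Ideal.Quotient.mk p s) = 0 :=
          Ideal.Quotient.eq_zero_iff_mem.2 (Ideal.mul_mem_right _ _ hrp)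
        rw [this, map_zero]
      have h3 : q (r • b • c) = 0 := by rw [map_smul]; exact h1.trans h2
      obtain ⟨d, hd⟩ := (Submodule.Quotient.mk_eq_zero _).1 h3
      refine ⟨d, hd.trans ?_⟩
      rw [smul_smul, mul_comm]
      rfl
    obtain ⟨t, rfl⟩ := hb.2 ψ
    refine ⟨t, hb.1 ?_⟩
    rw [← hψ, ← smul_eq_mul, map_smul]
  have hpre (g : Module.Dual A C) : ∃ g' : Module.Dual A C, a • g' = b • g :=
    exists_smul_eq (inj hc₀) (b • g) fun c => hpb _ (hmem g c)
  -- Multiplication by `b / a` on `C*` is a homothety since `C*` is reflexive of rank one.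
  obtain ⟨Ψ, hΨ⟩ := exists_smul_eq (inj hc₀) (LinearMap.lsmul A (Module.Dual A C) b) hpre
  obtain ⟨t, rfl⟩ := (bijective_lsmul A (Module.Dual A C) hrd).2 Ψ
  have hab : a * t = b := by
    apply (bijective_lsmul A (Module.Dual A C) hrd).1
    rw [← hΨ, ← smul_eq_mul, map_smul]
  apply hf₀
  ext c
  apply hj'
  have h1 := LinearMap.congr_fun hk c
  refine h1.symm.trans (Eq.trans ?_ (map_zero j').symm)
  refine (Submodule.Quotient.mk_eq_zero _).2 ⟨t • c, ?_⟩
  rw [← hab, LinearMap.lsmul_apply, smul_smul]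
  rfl

theorem S0_subset_Cl (A : Type u) [CommRing A] [IsNormalDomain A] : S0 A ⊆ Cl A := by
  rintro _ ⟨C, _, _, h, rfl⟩
  exact mk_mem_Cl.2 ⟨h.finite, h.isReflexive, h.rank_eq_one⟩

end Divisorial

/-! ### Homomorphisms and flat tensor products -/

section HomTensor

variable (D : Type u) {R : Type u} [CommRing D] [CommRing R] [Algebra D R]
  (M C N : Type u) [AddCommGroup M] [Module R M]
  [AddCommGroup C] [Module R C] [Module D C] [IsScalarTower D R C] [AddCommGroup N] [Module D N]

/-- The natural map `Hom_R(M, C) ⊗_D N → Hom_R(M, C ⊗_D N)`. -/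
def homTensor : (M →ₗ[R] C) ⊗[D] N →ₗ[D] (M →ₗ[R] C ⊗[D] N) :=
  TensorProduct.lift <| LinearMap.mk₂ D
    (fun f n => (AlgebraTensorModule.mk D R C N).flip n ∘ₗ f)
    (fun f f' n => LinearMap.comp_add _ _ _)
    (fun d f n => by ext m; exact (TensorProduct.smul_tmul' d (f m) n).symm)
    (fun f n n' => by rw [map_add, LinearMap.add_comp])
    (fun d f n => by rw [map_smul, LinearMap.smul_comp])

variable {D M C N} in
@[simp]
theorem homTensor_tmul (f : M →ₗ[R] C) (n : N) (m : M) :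
    homTensor D (R := R) M C N (f ⊗ₜ n) m = f m ⊗ₜ n := rfl

variable {M} in
theorem homTensor_lcomp {M' : Type u} [AddCommGroup M'] [Module R M'] (f : M →ₗ[R] M')
    (z : (M' →ₗ[R] C) ⊗[D] N) :
    homTensor D (R := R) M C N ((LinearMap.lcomp D C f).rTensor N z) =
      homTensor D (R := R) M' C N z ∘ₗ f := by
  induction z using TensorProduct.induction_on with
  | zero => simp
  | add a b ha hb => rw [map_add, map_add, ha, hb, map_add, LinearMap.add_comp]
  | tmul g n => rfl

theorem homTensor_bijective_of_free (ι : Type) [Finite ι] :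
    Function.Bijective (homTensor D (R := R) (ι → R) C N) := by
  classical
  have := Fintype.ofFinite ι
  let b := Pi.basisFun R ι
  let e := LinearEquiv.rTensor N (b.constr (M' := C) D).symm ≪≫ₗ
    TensorProduct.piLeft (R := D) (N := N) (M := fun _ : ι => C) ≪≫ₗ
    b.constr (M' := C ⊗[D] N) D
  have he : homTensor D (R := R) (ι → R) C N = e.toLinearMap := by
    refine TensorProduct.ext' fun f n => b.ext fun i => ?_
    simp [e]
  rw [he]
  exact e.bijective

/-- Left exactness of `Hom(-, C)` and flatness of `N` reduce this to free modules. -/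
theorem homTensor_bijective [Module.FinitePresentation R M] [Module.Flat D N] :
    Function.Bijective (homTensor D (R := R) M C N) := by
  obtain ⟨n, m, f, g, hf, hfg⟩ := Module.FinitePresentation.exists_fin' R M
  have hF := homTensor_bijective_of_free D (R := R) C N (Fin n)
  have hG := homTensor_bijective_of_free D (R := R) C N (Fin m)
  have hinj : Function.Injective ((LinearMap.lcomp D C f).rTensor N) :=
    Module.Flat.rTensor_preserves_injective_linearMap _ hf.injective_linearMapComp_right
  have hex : Function.Exact ((LinearMap.lcomp D C f).rTensor N)
      ((LinearMap.lcomp D C g).rTensor N) := by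
    refine Module.Flat.rTensor_exact N ?_
    exact LinearMap.exact_lcomp_of_exact_of_surjective (R := R) (N := C) hfg hf
  constructor
  · rw [injective_iff_map_eq_zero]
    intro z hz
    apply hinj
    apply hF.1
    rw [homTensor_lcomp, hz, LinearMap.zero_comp, map_zero, map_zero]
  · intro φ
    obtain ⟨y, hy⟩ := hF.2 (φ ∘ₗ f)
    obtain ⟨z, rfl⟩ := (hex y).1 (hG.1 (by
      rw [homTensor_lcomp, hy, map_zero, LinearMap.comp_assoc, hfg.linearMap_comp_eq_zero,
        LinearMap.comp_zero]))
    refine ⟨z, ?_⟩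
    rw [homTensor_lcomp] at hy
    exact hf.injective_linearMapComp_right hy

end HomTensor

/-! ### Maps between external tensor products -/

section Map

variable {D R₁ R₂ : Type u} [CommRing D] [CommRing R₁] [CommRing R₂] [Algebra D R₁] [Algebra D R₂]
  {M₁ M₂ N₁ N₂ P₁ P₂ : Type u}
  [AddCommGroup M₁] [Module R₁ M₁] [Module D M₁] [IsScalarTower D R₁ M₁]
  [AddCommGroup M₂] [Module R₂ M₂] [Module D M₂] [IsScalarTower D R₂ M₂]
  [AddCommGroup N₁] [Module R₁ N₁] [Module D N₁] [IsScalarTower D R₁ N₁]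
  [AddCommGroup N₂] [Module R₂ N₂] [Module D N₂] [IsScalarTower D R₂ N₂]
  [AddCommGroup P₁] [Module R₁ P₁] [Module D P₁] [IsScalarTower D R₁ P₁]
  [AddCommGroup P₂] [Module R₂ P₂] [Module D P₂] [IsScalarTower D R₂ P₂]

namespace ExtTensor

variable (D) in
/-- Functoriality of `M₁ ⊗_D M₂` over `R₁ ⊗_D R₂`. -/
def map (f₁ : M₁ →ₗ[R₁] N₁) (f₂ : M₂ →ₗ[R₂] N₂) :
    ExtTensor D M₁ M₂ →ₗ[R₁ ⊗[D] R₂] ExtTensor D N₁ N₂ :=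
  let f : M₁ ⊗[D] M₂ →ₗ[D] N₁ ⊗[D] N₂ :=
    TensorProduct.map (f₁.restrictScalars D) (f₂.restrictScalars D)
  { f with
    map_smul' := fun t x => linear_of_pure (P := ExtTensor D N₁ N₂)
      (f.toAddMonoidHom : M₁ ⊗[D] M₂ →+ N₁ ⊗[D] N₂) (fun r₁ r₂ m₁ m₂ => by
        change (f₁ (r₁ • m₁)) ⊗ₜ[D] (f₂ (r₂ • m₂)) = (r₁ • f₁ m₁) ⊗ₜ[D] (r₂ • f₂ m₂)
        rw [map_smul, map_smul]) t x }

theorem sum_tmul {ι : Type*} (s : Finset ι) (f : ι → M₁) (m₂ : M₂) :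
    tmul D (∑ i ∈ s, f i) m₂ = ∑ i ∈ s, tmul D (f i) m₂ :=
  map_sum (AddMonoidHom.mk' (fun m₁ => tmul D m₁ m₂) fun _ _ => add_tmul _ _ _ _ _) f s

theorem tmul_sum {ι : Type*} (m₁ : M₁) (s : Finset ι) (f : ι → M₂) :
    tmul D m₁ (∑ i ∈ s, f i) = ∑ i ∈ s, tmul D m₁ (f i) :=
  map_sum (AddMonoidHom.mk' (fun m₂ => tmul D m₁ m₂) fun _ _ => tmul_add _ _ _ _ _) f s

theorem hom_ext {P : Type u} [AddCommGroup P] [Module (R₁ ⊗[D] R₂) P]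
    {f g : ExtTensor D M₁ M₂ →ₗ[R₁ ⊗[D] R₂] P}
    (h : ∀ m₁ m₂, f (tmul D m₁ m₂) = g (tmul D m₁ m₂)) : f = g := by
  ext x
  induction x using ExtTensor.induction with
  | zero => rw [map_zero, map_zero]
  | tmul m₁ m₂ => exact h m₁ m₂
  | add x y hx hy => rw [map_add, map_add, hx, hy]

theorem map_comp_map (f₁ : M₁ →ₗ[R₁] N₁) (f₂ : M₂ →ₗ[R₂] N₂) (g₁ : N₁ →ₗ[R₁] P₁)
    (g₂ : N₂ →ₗ[R₂] P₂) : map D g₁ g₂ ∘ₗ map D f₁ f₂ = map D (g₁ ∘ₗ f₁) (g₂ ∘ₗ f₂) :=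
  hom_ext fun _ _ => rfl

theorem map_injective_left [Module.Flat D M₂] {f : M₁ →ₗ[R₁] N₁} (h : Function.Injective f) :
    Function.Injective (map D f (.id : M₂ →ₗ[R₂] M₂)) :=
  Module.Flat.rTensor_preserves_injective_linearMap (M := M₂) (f.restrictScalars D) h

theorem map_injective_right [Module.Flat D M₁] {f : M₂ →ₗ[R₂] N₂} (h : Function.Injective f) :
    Function.Injective (map D (.id : M₁ →ₗ[R₁] M₁) f) :=
  Module.Flat.lTensor_preserves_injective_linearMap (M := M₁) (f.restrictScalars D) h

theorem map_surjective {f₁ : M₁ →ₗ[R₁] N₁} {f₂ : M₂ →ₗ[R₂] N₂} (h₁ : Function.Surjective f₁)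
    (h₂ : Function.Surjective f₂) : Function.Surjective (map D f₁ f₂) :=
  TensorProduct.map_surjective (g := f₁.restrictScalars D) h₁ (g' := f₂.restrictScalars D) h₂

theorem exact_map_left {f : M₁ →ₗ[R₁] N₁} {g : N₁ →ₗ[R₁] P₁} (h : Function.Exact f g)
    (hg : Function.Surjective g) :
    Function.Exact (map D f (.id : M₂ →ₗ[R₂] M₂)) (map D g (.id : M₂ →ₗ[R₂] M₂)) :=
  rTensor_exact M₂ (f := f.restrictScalars D) (g := g.restrictScalars D) h hg

theorem exact_map_right {f : M₂ →ₗ[R₂] N₂} {g : N₂ →ₗ[R₂] P₂} (h : Function.Exact f g)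
    (hg : Function.Surjective g) :
    Function.Exact (map D (.id : M₁ →ₗ[R₁] M₁) f) (map D (.id : M₁ →ₗ[R₁] M₁) g) :=
  lTensor_exact M₁ (f := f.restrictScalars D) (g := g.restrictScalars D) h hg

variable (D R₁ R₂ M₁ M₂) in
theorem finite [Module.Finite R₁ M₁] [Module.Finite R₂ M₂] :
    Module.Finite (R₁ ⊗[D] R₂) (ExtTensor D M₁ M₂) := by
  obtain ⟨s₁, h₁⟩ := Module.Finite.fg_top (R := R₁) (M := M₁)
  obtain ⟨s₂, h₂⟩ := Module.Finite.fg_top (R := R₂) (M := M₂)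
  refine ⟨Submodule.fg_def.2 ⟨Set.image2 (tmul D) s₁ s₂, s₁.finite_toSet.image2 _ s₂.finite_toSet,
    Submodule.eq_top_iff'.2 fun x => ?_⟩⟩
  induction x using ExtTensor.induction with
  | zero => exact zero_mem _
  | add x y hx hy => exact add_mem hx hy
  | tmul m₁ m₂ =>
    have hm₁ : m₁ ∈ Submodule.span R₁ (s₁ : Set M₁) := h₁ ▸ Submodule.mem_top
    have hm₂ : m₂ ∈ Submodule.span R₂ (s₂ : Set M₂) := h₂ ▸ Submodule.mem_top
    induction hm₁ using Submodule.span_induction with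
    | zero => rw [zero_tmul]; exact zero_mem _
    | add x y _ _ hx hy => rw [add_tmul]; exact add_mem hx hy
    | smul a x _ hx => rw [smul_tmul₁ (R₂ := R₂)]; exact Submodule.smul_mem _ _ hx
    | mem x hx =>
      induction hm₂ using Submodule.span_induction with
      | zero => rw [tmul_zero]; exact zero_mem _
      | add x y _ _ hx hy => rw [tmul_add]; exact add_mem hx hy
      | smul a x _ hx => rw [smul_tmul₂ (R₁ := R₁)]; exact Submodule.smul_mem _ _ hx
      | mem y hy => exact Submodule.subset_span ⟨x, hx, y, hy, rfl⟩

variable (D R₁ R₂) in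
/-- The external tensor product of the `R₁`-module `R₁` and the `R₂`-module `R₂` is the ring
`R₁ ⊗_D R₂` as a module over itself. -/
def selfEquiv : ExtTensor D R₁ R₂ ≃ₗ[R₁ ⊗[D] R₂] R₁ ⊗[D] R₂ :=
  { (LinearEquiv.refl D (R₁ ⊗[D] R₂)) with
    map_smul' := linear_of_pure (D := D) (M₁ := R₁) (M₂ := R₂)
      (AddMonoidHom.id (R₁ ⊗[D] R₂)) fun _ _ _ _ =>
        (Algebra.TensorProduct.tmul_mul_tmul _ _ _ _).symm }

variable (D R₁ R₂ M₁ M₂) in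
/-- Coordinates with respect to bases split `x ↦ ∑ x i j • (b i ⊗ c j)`. -/
theorem projective_of_free [Module.Free R₁ M₁] [Module.Finite R₁ M₁] [Module.Free R₂ M₂]
    [Module.Finite R₂ M₂] : Module.Projective (R₁ ⊗[D] R₂) (ExtTensor D M₁ M₂) := by
  let b := Module.Free.chooseBasis R₁ M₁
  let c := Module.Free.chooseBasis R₂ M₂
  let s : ExtTensor D M₁ M₂ →ₗ[R₁ ⊗[D] R₂]
      (Module.Free.ChooseBasisIndex R₁ M₁ × Module.Free.ChooseBasisIndex R₂ M₂ → R₁ ⊗[D] R₂) :=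
    LinearMap.pi fun p => (selfEquiv D R₁ R₂).toLinearMap ∘ₗ map D (b.coord p.1) (c.coord p.2)
  let q := Fintype.linearCombination (R₁ ⊗[D] R₂)
    (fun p : Module.Free.ChooseBasisIndex R₁ M₁ × Module.Free.ChooseBasisIndex R₂ M₂ =>
      tmul D (b p.1) (c p.2))
  refine Module.Projective.of_split s q (hom_ext fun m₁ m₂ => ?_)
  have h₁ := b.sum_repr m₁
  have h₂ := c.sum_repr m₂
  rw [LinearMap.comp_apply, Fintype.linearCombination_apply, LinearMap.id_apply]
  have h (p) : s (tmul D m₁ m₂) p • tmul D (b p.1) (c p.2) =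
      tmul D (b.repr m₁ p.1 • b p.1) (c.repr m₂ p.2 • c p.2) := rfl
  simp only [h]
  rw [Fintype.sum_prod_type]
  conv_rhs => rw [← h₁, ← h₂]
  rw [sum_tmul]
  exact Finset.sum_congr rfl fun i _ => Eq.symm (tmul_sum (b.repr m₁ i • b i) _ _)

end ExtTensor

end Map

/-! ### Maps between external tensor products are sums of maps `f ⊗ g` -/

section HomGenerated

variable {D R₁ R₂ : Type u} [CommRing D] [CommRing R₁] [CommRing R₂] [Algebra D R₁] [Algebra D R₂]
  {M₁ M₂ N₁ N₂ : Type u}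
  [AddCommGroup M₁] [Module R₁ M₁] [Module D M₁] [IsScalarTower D R₁ M₁]
  [AddCommGroup M₂] [Module R₂ M₂] [Module D M₂] [IsScalarTower D R₂ M₂]
  [AddCommGroup N₁] [Module R₁ N₁] [Module D N₁] [IsScalarTower D R₁ N₁]
  [AddCommGroup N₂] [Module R₂ N₂] [Module D N₂] [IsScalarTower D R₂ N₂]

namespace ExtTensor

variable (D N₁ N₂) in
/-- The symmetry `N₁ ⊗_D N₂ ≅ N₂ ⊗_D N₁`. -/
def swap : ExtTensor D N₁ N₂ ≃+ N₂ ⊗[D] N₁ := (TensorProduct.comm D N₁ N₂).toAddEquiv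

theorem swap_smul (r : R₂) (x : ExtTensor D N₁ N₂) :
    swap D N₁ N₂ (((1 : R₁) ⊗ₜ[D] r) • x) = r • swap D N₁ N₂ x := by
  induction x using ExtTensor.induction with
  | zero => simp
  | add x y hx hy => rw [smul_add, map_add, hx, hy, map_add, smul_add]
  | tmul a b => rw [tmul_smul_tmul, one_smul]; rfl

/-- By tensor-hom adjunction and `homTensor_bijective`, applied over each ring,
`Hom(M₁ ⊗ M₂, N₁ ⊗ N₂) = Hom(M₁, Hom(M₂, N₁ ⊗ N₂)) = Hom(M₁, N₁ ⊗ Hom(M₂, N₂)) =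
Hom(M₁, N₁) ⊗ Hom(M₂, N₂)`. -/
theorem mem_closure_map [Module.FinitePresentation R₁ M₁] [Module.FinitePresentation R₂ M₂]
    [Module.Flat D N₁] [Module.Flat D (M₂ →ₗ[R₂] N₂)]
    (φ : ExtTensor D M₁ M₂ →ₗ[R₁ ⊗[D] R₂] ExtTensor D N₁ N₂) :
    φ ∈ AddSubmonoid.closure
      (Set.range fun p : (M₁ →ₗ[R₁] N₁) × (M₂ →ₗ[R₂] N₂) => map D p.1 p.2) := by
  let E : N₁ ⊗[D] (M₂ →ₗ[R₂] N₂) ≃+ (M₂ →ₗ[R₂] N₂ ⊗[D] N₁) :=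
    (TensorProduct.comm D N₁ _ ≪≫ₗ
      LinearEquiv.ofBijective _ (homTensor_bijective D (R := R₂) M₂ N₂ N₁)).toAddEquiv
  have hE (n : N₁) (g : M₂ →ₗ[R₂] N₂) (m : M₂) :
      E (n ⊗ₜ g) m = swap D N₁ N₂ (tmul D n (g m)) := rfl
  have hEsmul (r : R₁) (y : N₁ ⊗[D] (M₂ →ₗ[R₂] N₂)) (m : M₂) : E (r • y) m =
      swap D N₁ N₂ ((r ⊗ₜ[D] (1 : R₂)) • (swap D N₁ N₂).symm (E y m)) := by
    induction y using TensorProduct.induction_on with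
    | zero => simp
    | add x y hx hy =>
      rw [smul_add, map_add, LinearMap.add_apply, hx, hy, map_add, LinearMap.add_apply, map_add,
        smul_add, map_add]
    | tmul n g =>
      rw [TensorProduct.smul_tmul', hE, hE, AddEquiv.symm_apply_apply, ← smul_tmul₁ (R₂ := R₂)]
  -- `φ` curried, and then rewritten as a map to `N₁ ⊗ Hom(M₂, N₂)`.
  let Φ (m₁ : M₁) : M₂ →ₗ[R₂] N₂ ⊗[D] N₁ :=
    { toFun := fun m₂ => swap D N₁ N₂ (φ (tmul D m₁ m₂))
      map_add' := fun a b => by rw [tmul_add, map_add, map_add]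
      map_smul' := fun r m₂ => by
        rw [smul_tmul₂ (R₁ := R₁), map_smul, swap_smul, RingHom.id_apply] }
  let ψ : M₁ →ₗ[R₁] N₁ ⊗[D] (M₂ →ₗ[R₂] N₂) :=
    { toFun := fun m₁ => E.symm (Φ m₁)
      map_add' := fun a b => by
        rw [← map_add]
        congr 1
        ext m₂
        change swap D N₁ N₂ (φ (tmul D (a + b) m₂)) =
          swap D N₁ N₂ (φ (tmul D a m₂)) + swap D N₁ N₂ (φ (tmul D b m₂))
        rw [add_tmul, map_add, map_add]
      map_smul' := fun r m₁ => by
        apply E.injective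
        rw [AddEquiv.apply_symm_apply]
        ext m₂
        rw [RingHom.id_apply, hEsmul, AddEquiv.apply_symm_apply]
        change swap D N₁ N₂ (φ (tmul D (r • m₁) m₂)) =
          swap D N₁ N₂ (_ • (swap D N₁ N₂).symm (swap D N₁ N₂ (φ (tmul D m₁ m₂))))
        rw [smul_tmul₁ (R₂ := R₂), map_smul, AddEquiv.symm_apply_apply] }
  have hψ (m₁ : M₁) (m₂ : M₂) : swap D N₁ N₂ (φ (tmul D m₁ m₂)) = E (ψ m₁) m₂ :=
    (LinearMap.congr_fun (E.apply_symm_apply (Φ m₁)) m₂).symm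
  have key (z : (M₁ →ₗ[R₁] N₁) ⊗[D] (M₂ →ₗ[R₂] N₂)) : ∃ φ' ∈ AddSubmonoid.closure
      (Set.range fun p : (M₁ →ₗ[R₁] N₁) × (M₂ →ₗ[R₂] N₂) => map D p.1 p.2), ∀ m₁ m₂,
      swap D N₁ N₂ (φ' (tmul D m₁ m₂)) =
        E (homTensor D (R := R₁) M₁ N₁ (M₂ →ₗ[R₂] N₂) z m₁) m₂ := by
    induction z using TensorProduct.induction_on with
    | zero => exact ⟨0, zero_mem _, fun m₁ m₂ => by simp⟩
    | tmul f g => exact ⟨_, AddSubmonoid.subset_closure ⟨(f, g), rfl⟩, fun m₁ m₂ => rfl⟩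
    | add x y hx hy =>
      obtain ⟨a, ha, hx⟩ := hx
      obtain ⟨b, hb, hy⟩ := hy
      refine ⟨a + b, add_mem ha hb, fun m₁ m₂ => ?_⟩
      rw [LinearMap.add_apply, map_add, hx, hy, map_add, LinearMap.add_apply, map_add,
        LinearMap.add_apply]
  obtain ⟨z, hz⟩ := (homTensor_bijective D (R := R₁) M₁ N₁ (M₂ →ₗ[R₂] N₂)).2 ψ
  obtain ⟨φ', hφ', h⟩ := key z
  have : φ = φ' := hom_ext fun m₁ m₂ => (swap D N₁ N₂).injective (by rw [hψ, h, hz])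
  rwa [this]

end ExtTensor
end HomGenerated

/-! ### Vanishing of Ext over a tensor product of algebras -/

section ExtVanishing

section Acyclic
variable {A : Type u} [CommRing A] {K F M : Type u} [AddCommGroup K] [Module A K]
  [AddCommGroup F] [Module A F] [AddCommGroup M] [Module A M] {i : K →ₗ[A] F} {f : F →ₗ[A] M}

/-- The criterion `ext_one_iff` with an acyclic middle term in place of a projective one. -/
theorem subsingleton_ext_one_of_acyclic (hi : Function.Injective i) (he : Function.Exact i f)
    (hf : Function.Surjective f) (N : Type u) [AddCommGroup N] [Module A N]
    (hF : Subsingleton (Ext (ModuleCat.of A F) (ModuleCat.of A N) 1))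
    (H : ∀ g : K →ₗ[A] N, ∃ k : F →ₗ[A] N, k ∘ₗ i = g) :
    Subsingleton (Ext (ModuleCat.of A M) (ModuleCat.of A N) 1) := by
  have h := shortExact_of hi he hf
  refine subsingleton_of_forall_eq 0 fun x => ?_
  obtain ⟨y, rfl⟩ := Ext.contravariant_sequence_exact₃ h (ModuleCat.of A N) x
    (Subsingleton.elim (α := Ext (ModuleCat.of A F) (ModuleCat.of A N) 1) _ _) (add_zero 1)
  obtain ⟨g, rfl⟩ := (Ext.mk₀_bijective _ _).2 y
  obtain ⟨k, hk⟩ := H g.hom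
  obtain rfl : ModuleCat.ofHom i ≫ ModuleCat.ofHom k = g := ModuleCat.hom_ext hk
  refine Eq.trans ?_ (h.extClass_comp_assoc (Ext.mk₀ (ModuleCat.ofHom k)) (h := add_zero 1))
  exact congrArg (fun z => h.extClass.comp z (add_zero 1)) (Ext.mk₀_comp_mk₀ _ _).symm

theorem subsingleton_ext_succ_of_acyclic (hi : Function.Injective i) (he : Function.Exact i f)
    (hf : Function.Surjective f) (N : Type u) [AddCommGroup N] [Module A N] (n : ℕ)
    (hF : Subsingleton (Ext (ModuleCat.of A F) (ModuleCat.of A N) (n + 2)))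
    (hK : Subsingleton (Ext (ModuleCat.of A K) (ModuleCat.of A N) (n + 1))) :
    Subsingleton (Ext (ModuleCat.of A M) (ModuleCat.of A N) (n + 2)) := by
  have h := shortExact_of hi he hf
  refine subsingleton_of_forall_eq 0 fun x => ?_
  obtain ⟨y, rfl⟩ := Ext.contravariant_sequence_exact₃ h (ModuleCat.of A N) x
    (Subsingleton.elim (α := Ext (ModuleCat.of A F) (ModuleCat.of A N) (n + 2)) _ _)
    (show 1 + (n + 1) = n + 2 by ring)
  rw [Subsingleton.elim (α := Ext (ModuleCat.of A K) (ModuleCat.of A N) (n + 1)) y 0,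
    Ext.comp_zero]

end Acyclic

variable {D R₁ R₂ : Type u} [CommRing D] [IsDomain D] [IsPrincipalIdealRing D]
  [CommRing R₁] [CommRing R₂] [IsNoetherianRing R₁] [IsNoetherianRing R₂]
  [Algebra D R₁] [Algebra D R₂]
  {N₁ N₂ : Type u}
  [AddCommGroup N₁] [Module R₁ N₁] [Module D N₁] [IsScalarTower D R₁ N₁] [Module.Flat D N₁]
  [AddCommGroup N₂] [Module R₂ N₂] [Module D N₂] [IsScalarTower D R₂ N₂] [Module.Flat D N₂]

theorem flat_linearMap (M : Type u) [AddCommGroup M] [Module R₂ M] :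
    Module.Flat D (M →ₗ[R₂] N₂) := by
  have : Module.IsTorsionFree D (M →ₗ[R₂] N₂) :=
    Module.isTorsionFree_iff_smul_eq_zero.2 fun {d} {f} h => or_iff_not_imp_left.2 fun hd =>
      LinearMap.ext fun m => (smul_eq_zero.1 (LinearMap.congr_fun h m)).resolve_left hd
  infer_instance

/-- It suffices to extend maps `f₁ ⊗ f₂`, which generate all maps `K₁ ⊗ K₂ → N₁ ⊗ N₂`. -/
theorem exists_extension_of_exists_extension {K₁ K₂ F₁ F₂ : Type u}
    [AddCommGroup K₁] [Module R₁ K₁] [Module D K₁] [IsScalarTower D R₁ K₁] [Module.Finite R₁ K₁]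
    [AddCommGroup K₂] [Module R₂ K₂] [Module D K₂] [IsScalarTower D R₂ K₂] [Module.Finite R₂ K₂]
    [AddCommGroup F₁] [Module R₁ F₁] [Module D F₁] [IsScalarTower D R₁ F₁]
    [AddCommGroup F₂] [Module R₂ F₂] [Module D F₂] [IsScalarTower D R₂ F₂]
    (i₁ : K₁ →ₗ[R₁] F₁) (i₂ : K₂ →ₗ[R₂] F₂)
    (h₁ : ∀ g : K₁ →ₗ[R₁] N₁, ∃ k : F₁ →ₗ[R₁] N₁, k ∘ₗ i₁ = g)
    (h₂ : ∀ g : K₂ →ₗ[R₂] N₂, ∃ k : F₂ →ₗ[R₂] N₂, k ∘ₗ i₂ = g)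
    (g : ExtTensor D K₁ K₂ →ₗ[R₁ ⊗[D] R₂] ExtTensor D N₁ N₂) :
    ∃ k : ExtTensor D F₁ F₂ →ₗ[R₁ ⊗[D] R₂] ExtTensor D N₁ N₂, k ∘ₗ ExtTensor.map D i₁ i₂ = g := by
  have := Module.finitePresentation_of_finite R₁ K₁
  have := Module.finitePresentation_of_finite R₂ K₂
  have := flat_linearMap (D := D) (R₂ := R₂) (N₂ := N₂) K₂
  induction ExtTensor.mem_closure_map g using AddSubmonoid.closure_induction with
  | mem _ h =>
    obtain ⟨⟨f₁, f₂⟩, rfl⟩ := h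
    obtain ⟨k₁, rfl⟩ := h₁ f₁
    obtain ⟨k₂, rfl⟩ := h₂ f₂
    exact ⟨ExtTensor.map D k₁ k₂, ExtTensor.map_comp_map _ _ _ _⟩
  | zero => exact ⟨0, LinearMap.zero_comp _⟩
  | add _ _ _ _ hx hy =>
    obtain ⟨k, rfl⟩ := hx
    obtain ⟨l, rfl⟩ := hy
    exact ⟨k + l, LinearMap.add_comp _ _ _⟩

/-- The syzygies of `M₂` are tensored with `F₁`; maps out of the first syzygy extend because they
are sums of maps `f₁ ⊗ f₂`. -/
theorem subsingleton_ext_extTensor_of_free (F₁ : Type u) [AddCommGroup F₁] [Module R₁ F₁]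
    [Module D F₁] [IsScalarTower D R₁ F₁] [Module.Free R₁ F₁] [Module.Finite R₁ F₁]
    [Module.Flat D F₁] (n : ℕ)
    (M₂ : Type u) [AddCommGroup M₂] [Module R₂ M₂] [Module D M₂] [IsScalarTower D R₂ M₂]
    [Module.Finite R₂ M₂]
    (h : Subsingleton (Ext (ModuleCat.of R₂ M₂) (ModuleCat.of R₂ N₂) (n + 1))) :
    Subsingleton (Ext (ModuleCat.of (R₁ ⊗[D] R₂) (ExtTensor D F₁ M₂))
      (ModuleCat.of (R₁ ⊗[D] R₂) (ExtTensor D N₁ N₂)) (n + 1)) := by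
  induction n generalizing M₂ with
  | zero =>
    obtain ⟨F, _, _, _, _, f, hf⟩ := Module.exists_finite_presentation R₂ M₂
    let _ := Module.compHom F (algebraMap D R₂)
    have : IsScalarTower D R₂ F := .of_algebraMap_smul fun _ _ => rfl
    have he : Function.Exact (LinearMap.ker f).subtype f := LinearMap.exact_subtype_ker_map f
    have hi := Submodule.subtype_injective (LinearMap.ker f)
    rw [zero_add, ext_one_iff hi he hf] at h
    have := ExtTensor.projective_of_free D R₁ R₂ F₁ F
    rw [zero_add, ext_one_iff
      (ExtTensor.map_injective_right (D := D) (M₁ := F₁) (R₁ := R₁) hi)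
      (ExtTensor.exact_map_right (D := D) (M₁ := F₁) (R₁ := R₁) he hf)
      (ExtTensor.map_surjective Function.surjective_id hf)]
    exact exists_extension_of_exists_extension .id _ (fun g => ⟨g, rfl⟩) h
  | succ n ih =>
    obtain ⟨F, _, _, _, _, f, hf⟩ := Module.exists_finite_presentation R₂ M₂
    let _ := Module.compHom F (algebraMap D R₂)
    have : IsScalarTower D R₂ F := .of_algebraMap_smul fun _ _ => rfl
    have he : Function.Exact (LinearMap.ker f).subtype f := LinearMap.exact_subtype_ker_map f
    have hi := Submodule.subtype_injective (LinearMap.ker f)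
    rw [ext_succ_iff hi he hf] at h
    have := ExtTensor.projective_of_free D R₁ R₂ F₁ F
    rw [ext_succ_iff
      (ExtTensor.map_injective_right (D := D) (M₁ := F₁) (R₁ := R₁) hi)
      (ExtTensor.exact_map_right (D := D) (M₁ := F₁) (R₁ := R₁) he hf)
      (ExtTensor.map_surjective Function.surjective_id hf)]
    exact ih _ h

/-- Künneth vanishing: over a principal ideal domain the flat modules `Nᵢ` contribute no Tor terms.
The syzygies of `M₁` are used as in the computation of Ext, their tensor products with `M₂` being
acyclic by `subsingleton_ext_extTensor_of_free` rather than projective. -/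
theorem subsingleton_ext_extTensor [Module.Flat D R₁] (M₂ : Type u) [AddCommGroup M₂] [Module R₂ M₂]
    [Module D M₂] [IsScalarTower D R₂ M₂] [Module.Finite R₂ M₂] [Module.Flat D M₂]
    (h₂ : ∀ n : ℕ, Subsingleton (Ext (ModuleCat.of R₂ M₂) (ModuleCat.of R₂ N₂) (n + 1)))
    (n : ℕ) (M₁ : Type u) [AddCommGroup M₁] [Module R₁ M₁] [Module D M₁] [IsScalarTower D R₁ M₁]
    [Module.Finite R₁ M₁]
    (h₁ : Subsingleton (Ext (ModuleCat.of R₁ M₁) (ModuleCat.of R₁ N₁) (n + 1))) :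
    Subsingleton (Ext (ModuleCat.of (R₁ ⊗[D] R₂) (ExtTensor D M₁ M₂))
      (ModuleCat.of (R₁ ⊗[D] R₂) (ExtTensor D N₁ N₂)) (n + 1)) := by
  induction n generalizing M₁ with
  | zero =>
    obtain ⟨F, _, _, _, _, f, hf⟩ := Module.exists_finite_presentation R₁ M₁
    let _ := Module.compHom F (algebraMap D R₁)
    have : IsScalarTower D R₁ F := .of_algebraMap_smul fun _ _ => rfl
    have : Module.Flat D F := .trans D R₁ F
    have he : Function.Exact (LinearMap.ker f).subtype f := LinearMap.exact_subtype_ker_map f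
    have hi := Submodule.subtype_injective (LinearMap.ker f)
    rw [zero_add, ext_one_iff hi he hf] at h₁
    exact subsingleton_ext_one_of_acyclic
      (ExtTensor.map_injective_left (D := D) (M₂ := M₂) (R₂ := R₂) hi)
      (ExtTensor.exact_map_left (D := D) (M₂ := M₂) (R₂ := R₂) he hf)
      (ExtTensor.map_surjective hf Function.surjective_id) _
      (subsingleton_ext_extTensor_of_free F 0 M₂ (h₂ 0))
      (exists_extension_of_exists_extension _ .id h₁ fun g => ⟨g, rfl⟩)
  | succ n ih =>
    obtain ⟨F, _, _, _, _, f, hf⟩ := Module.exists_finite_presentation R₁ M₁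
    let _ := Module.compHom F (algebraMap D R₁)
    have : IsScalarTower D R₁ F := .of_algebraMap_smul fun _ _ => rfl
    have : Module.Flat D F := .trans D R₁ F
    have he : Function.Exact (LinearMap.ker f).subtype f := LinearMap.exact_subtype_ker_map f
    have hi := Submodule.subtype_injective (LinearMap.ker f)
    rw [ext_succ_iff hi he hf] at h₁
    exact subsingleton_ext_succ_of_acyclic
      (ExtTensor.map_injective_left (D := D) (M₂ := M₂) (R₂ := R₂) hi)
      (ExtTensor.exact_map_left (D := D) (M₂ := M₂) (R₂ := R₂) he hf)
      (ExtTensor.map_surjective hf Function.surjective_id) _ n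
      (subsingleton_ext_extTensor_of_free F (n + 1) M₂ (h₂ (n + 1)))
      (ih _ h₁)

end ExtVanishing

/-! ### The tensor product of semidualizing modules -/

section Semidualizing

variable {D R₁ R₂ : Type u} [CommRing D] [IsDomain D] [IsPrincipalIdealRing D]
  [CommRing R₁] [CommRing R₂] [IsDomain R₁] [IsDomain R₂]
  [IsNoetherianRing R₁] [IsNoetherianRing R₂] [Algebra D R₁] [Algebra D R₂]

theorem IsSemidualizing.flat {C : Type u} [AddCommGroup C] [Module R₁ C] [Module D C]
    [IsScalarTower D R₁ C] (hinj : Function.Injective (algebraMap D R₁))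
    (h : IsSemidualizing R₁ C) : Module.Flat D C := by
  have := h.isTorsionFree
  have : Module.IsTorsionFree D C := Module.isTorsionFree_iff_smul_eq_zero.2 fun {d} {c} hdc => by
    rw [← algebraMap_smul R₁, smul_eq_zero] at hdc
    exact hdc.imp_left fun h => hinj (h.trans (map_zero _).symm)
  infer_instance

theorem IsSemidualizing.exists_injective {R C : Type u} [CommRing R] [IsDomain R]
    [IsNoetherianRing R] [AddCommGroup C] [Module R C] (h : IsSemidualizing R C) :
    ∃ f : R →ₗ[R] C, Function.Injective f := by
  have := h.isTorsionFree
  obtain ⟨c, hc⟩ : ∃ c : C, c ≠ 0 := by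
    by_contra! H
    have : Subsingleton C := subsingleton_of_forall_eq 0 H
    have := h.rank_eq_one
    rw [rank_subsingleton'] at this
    exact zero_ne_one this
  exact ⟨LinearMap.toSpanSingleton R C c, smul_left_injective R hc⟩

/-- Faithfulness: flatness over `D` gives embeddings `R₁ ⊗ R₂ → C₁ ⊗ R₂ → C₁ ⊗ C₂`. -/
theorem IsSemidualizing.injective_lsmul_extTensor {C₁ C₂ : Type u}
    [AddCommGroup C₁] [Module R₁ C₁] [Module D C₁] [IsScalarTower D R₁ C₁]
    [AddCommGroup C₂] [Module R₂ C₂] [Module D C₂] [IsScalarTower D R₂ C₂]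
    (hi₁ : Function.Injective (algebraMap D R₁)) (hi₂ : Function.Injective (algebraMap D R₂))
    (h₁ : IsSemidualizing R₁ C₁) (h₂ : IsSemidualizing R₂ C₂) :
    Function.Injective (LinearMap.lsmul (R₁ ⊗[D] R₂) (ExtTensor D C₁ C₂)) := by
  have := h₁.flat (D := D) hi₁
  have : Module.Flat D R₂ := flat_of_injective hi₂
  obtain ⟨f₁, hf₁⟩ := h₁.exists_injective
  obtain ⟨f₂, hf₂⟩ := h₂.exists_injective
  have hj := (ExtTensor.map_injective_right (D := D) (M₁ := C₁) (R₁ := R₁) hf₂).comp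
    ((ExtTensor.map_injective_left (D := D) (M₂ := R₂) (R₂ := R₂) hf₁).comp
      (ExtTensor.selfEquiv D R₁ R₂).symm.injective)
  intro s t hst
  apply hj
  rw [← mul_one s, ← mul_one t, ← smul_eq_mul, ← smul_eq_mul]
  simp only [Function.comp_apply, map_smul]
  exact LinearMap.congr_fun hst _

/-- Endomorphisms of `C₁ ⊗ C₂` are sums of maps `f ⊗ g`, and `f` and `g` are homotheties. -/
theorem IsSemidualizing.surjective_lsmul_extTensor {C₁ C₂ : Type u}
    [AddCommGroup C₁] [Module R₁ C₁] [Module D C₁] [IsScalarTower D R₁ C₁]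
    [AddCommGroup C₂] [Module R₂ C₂] [Module D C₂] [IsScalarTower D R₂ C₂]
    (hi₁ : Function.Injective (algebraMap D R₁)) (hi₂ : Function.Injective (algebraMap D R₂))
    (h₁ : IsSemidualizing R₁ C₁) (h₂ : IsSemidualizing R₂ C₂) :
    Function.Surjective (LinearMap.lsmul (R₁ ⊗[D] R₂) (ExtTensor D C₁ C₂)) := by
  have := h₁.finite
  have := h₂.finite
  have := Module.finitePresentation_of_finite R₁ C₁
  have := Module.finitePresentation_of_finite R₂ C₂
  have := h₁.flat (D := D) hi₁
  have := h₂.flat (D := D) hi₂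
  have := flat_linearMap (D := D) (R₂ := R₂) (N₂ := C₂) C₂
  obtain ⟨e₁⟩ := h₁.end_equiv
  obtain ⟨e₂⟩ := h₂.end_equiv
  intro φ
  induction ExtTensor.mem_closure_map φ using AddSubmonoid.closure_induction with
  | mem _ h =>
    obtain ⟨⟨f, g⟩, rfl⟩ := h
    obtain ⟨r, rfl⟩ := (bijective_lsmul_of_end_equiv e₁).2 f
    obtain ⟨s, rfl⟩ := (bijective_lsmul_of_end_equiv e₂).2 g
    exact ⟨r ⊗ₜ s, ExtTensor.hom_ext fun _ _ => rfl⟩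
  | zero => exact ⟨0, map_zero _⟩
  | add _ _ _ _ hx hy =>
    obtain ⟨s, rfl⟩ := hx
    obtain ⟨t, rfl⟩ := hy
    exact ⟨s + t, map_add _ _ _⟩

theorem IsSemidualizing.extTensor {C₁ C₂ : Type u}
    [AddCommGroup C₁] [Module R₁ C₁] [Module D C₁] [IsScalarTower D R₁ C₁]
    [AddCommGroup C₂] [Module R₂ C₂] [Module D C₂] [IsScalarTower D R₂ C₂]
    (hi₁ : Function.Injective (algebraMap D R₁)) (hi₂ : Function.Injective (algebraMap D R₂))
    (h₁ : IsSemidualizing R₁ C₁) (h₂ : IsSemidualizing R₂ C₂) :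
    IsSemidualizing (R₁ ⊗[D] R₂) (ExtTensor D C₁ C₂) where
  finite := have := h₁.finite; have := h₂.finite; ExtTensor.finite D R₁ R₂ C₁ C₂
  end_equiv := ⟨(LinearEquiv.ofBijective _ ⟨injective_lsmul_extTensor hi₁ hi₂ h₁ h₂,
    surjective_lsmul_extTensor hi₁ hi₂ h₁ h₂⟩).symm⟩
  ext_vanish n hn := by
    obtain ⟨n, rfl⟩ := Nat.exists_eq_add_of_le' hn
    have := h₁.finite
    have := h₂.finite
    have := h₁.flat (D := D) hi₁
    have := h₂.flat (D := D) hi₂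
    have : Module.Flat D R₁ := flat_of_injective hi₁
    exact subsingleton_ext_extTensor C₂ (fun m => h₂.ext_vanish _ m.succ_pos) n C₁
      (h₁.ext_vanish _ hn)

theorem tensorPreservesS0 (hi₁ : Function.Injective (algebraMap D R₁))
    (hi₂ : Function.Injective (algebraMap D R₂)) : TensorPreservesS0 D R₁ R₂ := by
  rintro _ ⟨C₁, _, _, h₁, rfl⟩ _ ⟨C₂, _, _, h₂, rfl⟩
  let _ := Module.compHom C₁ (algebraMap D R₁)
  let _ := Module.compHom C₂ (algebraMap D R₂)
  have : IsScalarTower D R₁ C₁ := .of_algebraMap_smul fun _ _ => rfl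
  have : IsScalarTower D R₂ C₂ := .of_algebraMap_smul fun _ _ => rfl
  rw [IsoClass.extTensor_mk]
  exact mk_mem_S0.2 (h₁.extTensor hi₁ hi₂ h₂)

end Semidualizing

/-! ### Base change to a tensor product of algebras -/

section BaseChange

/-- A module `P` with the universal property of `B ⊗_A M` represents its class. -/
theorem baseChange_mk_eq_of_universal {A B M P : Type u} [CommRing A] [CommRing B] (φ : A →+* B)
    [AddCommGroup M] [Module A M] [AddCommGroup P] [Module B P] (j : M →+ P)
    (hj : ∀ a m, j (a • m) = φ a • j m) (hspan : ∀ p, p ∈ Submodule.span B (Set.range j))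
    (huniv : ∀ (Q : Type u) [AddCommGroup Q] [Module B Q] (k : M →+ Q),
      (∀ a m, k (a • m) = φ a • k m) → ∃ G : P →ₗ[B] Q, ∀ m, G (j m) = k m) :
    (IsoClass.mk A M).baseChange φ = IsoClass.mk B P := by
  let _ := φ.toAlgebra
  have hφ (a : A) : algebraMap A B a = φ a := rfl
  let _ : Module A P := Module.compHom P φ
  have : IsScalarTower A B P := .of_algebraMap_smul fun _ _ => rfl
  let F : B ⊗[A] M →ₗ[B] P := LinearMap.liftBaseChange B { j with map_smul' := hj }
  have hF (m : M) : F (1 ⊗ₜ m) = j m := by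
    rw [LinearMap.liftBaseChange_tmul, one_smul]; rfl
  obtain ⟨G, hG⟩ := huniv (B ⊗[A] M) (TensorProduct.mk A B M 1).toAddMonoidHom fun a m => by
    change (1 : B) ⊗ₜ[A] (a • m) = φ a • ((1 : B) ⊗ₜ[A] m)
    rw [TensorProduct.tmul_smul, ← hφ, algebraMap_smul]
  refine IsoClass.mk_eq (LinearEquiv.ofLinearMap F G ?_ ?_)
  · ext p
    have hp := hspan p
    induction hp using Submodule.span_induction with
    | mem _ h =>
      obtain ⟨m, rfl⟩ := h
      rw [LinearMap.comp_apply, hG]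
      exact hF m
    | zero => rw [map_zero, map_zero]
    | add x y _ _ hx hy => rw [map_add, hx, hy, map_add]
    | smul b x _ hx => rw [map_smul, hx, map_smul]
  · ext m
    change G (F (1 ⊗ₜ m)) = 1 ⊗ₜ m
    rw [hF, hG]
    rfl

variable {D R₁ R₂ : Type u} [CommRing D] [CommRing R₁] [CommRing R₂] [Algebra D R₁] [Algebra D R₂]

open ExtTensor in
theorem baseChange_leftMap (x : IsoClass R₁) :
    x.baseChange (leftMap D R₁ R₂) = IsoClass.extTensor (D := D) x (.mk R₂ R₂) := by
  induction x using IsoClass.ind with | h M =>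
  let _ := Module.compHom M (algebraMap D R₁)
  have : IsScalarTower D R₁ M := .of_algebraMap_smul fun _ _ => rfl
  rw [IsoClass.extTensor_mk]
  refine baseChange_mk_eq_of_universal _
    (AddMonoidHom.mk' (fun m => ExtTensor.tmul D m (1 : R₂)) fun a b => add_tmul _ _ a b 1)
    (fun a m => smul_tmul₁ _ _ a m 1) (fun p => ?_) (fun Q _ _ k hk => ?_)
  · induction p using ExtTensor.induction with
    | zero => exact zero_mem _
    | add x y hx hy => exact add_mem hx hy
    | tmul m r =>
      rw [← mul_one r, ← smul_eq_mul, smul_tmul₂ (R₁ := R₁)]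
      exact Submodule.smul_mem _ _ (Submodule.subset_span ⟨m, rfl⟩)
  · let G : M ⊗[D] R₂ →+ Q := lift₂ (fun m r => ((1 : R₁) ⊗ₜ[D] r) • k m)
      (fun _ _ _ => by rw [map_add, smul_add])
      (fun _ _ _ => by rw [TensorProduct.tmul_add, add_smul])
      (fun d m r => by
        rw [← algebraMap_smul R₁ d m, hk, smul_smul]
        congr 1
        change (1 : R₁) ⊗ₜ[D] r * (algebraMap D R₁ d ⊗ₜ[D] (1 : R₂)) = _
        rw [Algebra.TensorProduct.tmul_mul_tmul, one_mul, mul_one, Algebra.algebraMap_eq_smul_one,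
          TensorProduct.smul_tmul])
    refine ⟨{ G with map_smul' := linear_of_pure (M₁ := M) (M₂ := R₂) G fun r₁ r₂ m r => ?_ },
      fun m => ?_⟩
    · change ((1 : R₁) ⊗ₜ[D] (r₂ • r)) • k (r₁ • m) = (r₁ ⊗ₜ[D] r₂) • ((1 : R₁) ⊗ₜ[D] r) • k m
      rw [hk, smul_smul, smul_smul]
      congr 1
      change _ * (r₁ ⊗ₜ[D] (1 : R₂)) = _
      rw [Algebra.TensorProduct.tmul_mul_tmul, Algebra.TensorProduct.tmul_mul_tmul, one_mul,
        mul_one, mul_one, smul_eq_mul]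
    · change ((1 : R₁) ⊗ₜ[D] (1 : R₂)) • k m = k m
      rw [← Algebra.TensorProduct.one_def, one_smul]

open ExtTensor in
theorem baseChange_rightMap (x : IsoClass R₂) :
    x.baseChange (rightMap D R₁ R₂) = IsoClass.extTensor (D := D) (.mk R₁ R₁) x := by
  induction x using IsoClass.ind with | h M =>
  let _ := Module.compHom M (algebraMap D R₂)
  have : IsScalarTower D R₂ M := .of_algebraMap_smul fun _ _ => rfl
  rw [IsoClass.extTensor_mk]
  refine baseChange_mk_eq_of_universal _
    (AddMonoidHom.mk' (fun m => ExtTensor.tmul D (1 : R₁) m) fun a b => tmul_add _ _ 1 a b)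
    (fun a m => smul_tmul₂ _ _ a 1 m) (fun p => ?_) (fun Q _ _ k hk => ?_)
  · induction p using ExtTensor.induction with
    | zero => exact zero_mem _
    | add x y hx hy => exact add_mem hx hy
    | tmul r m =>
      rw [← mul_one r, ← smul_eq_mul, smul_tmul₁ (R₂ := R₂)]
      exact Submodule.smul_mem _ _ (Submodule.subset_span ⟨m, rfl⟩)
  · let G : R₁ ⊗[D] M →+ Q := lift₂ (fun r m => (r ⊗ₜ[D] (1 : R₂)) • k m)
      (fun _ _ _ => by rw [TensorProduct.add_tmul, add_smul])
      (fun _ _ _ => by rw [map_add, smul_add])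
      (fun d r m => by
        rw [← algebraMap_smul R₂ d m, hk, smul_smul]
        congr 1
        change _ = r ⊗ₜ[D] (1 : R₂) * ((1 : R₁) ⊗ₜ[D] algebraMap D R₂ d)
        rw [Algebra.TensorProduct.tmul_mul_tmul, one_mul, mul_one, Algebra.algebraMap_eq_smul_one,
          TensorProduct.smul_tmul])
    refine ⟨{ G with map_smul' := linear_of_pure (M₁ := R₁) (M₂ := M) G fun r₁ r₂ r m => ?_ },
      fun m => ?_⟩
    · change ((r₁ • r) ⊗ₜ[D] (1 : R₂)) • k (r₂ • m) = (r₁ ⊗ₜ[D] r₂) • (r ⊗ₜ[D] (1 : R₂)) • k m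
      rw [hk, smul_smul, smul_smul]
      congr 1
      change _ * ((1 : R₁) ⊗ₜ[D] r₂) = _
      rw [Algebra.TensorProduct.tmul_mul_tmul, Algebra.TensorProduct.tmul_mul_tmul, one_mul,
        mul_one, mul_one, smul_eq_mul]
    · change ((1 : R₁) ⊗ₜ[D] (1 : R₂)) • k m = k m
      rw [← Algebra.TensorProduct.one_def, one_smul]

theorem baseChange_leftMap_tensor_baseChange_rightMap (x : IsoClass R₁) (y : IsoClass R₂) :
    (x.baseChange (leftMap D R₁ R₂)).tensor (y.baseChange (rightMap D R₁ R₂)) =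
      IsoClass.extTensor (D := D) x y := by
  rw [baseChange_leftMap, baseChange_rightMap, ← extTensor_tensor, tensor_comm x, one_tensor,
    one_tensor]

end BaseChange

end SDM

end

theorem theorem4p4 {D R₁ R₂ S₁ S₂ : Type u}
    [CommRing D] [IsDomain D] [IsPrincipalIdealRing D]
    [CommRing R₁] [IsNormalDomain R₁] [CommRing R₂] [IsNormalDomain R₂]
    [Algebra D R₁] [Algebra D R₂]
    (hf₁ : Function.Injective (algebraMap D R₁)) (hf₂ : Function.Injective (algebraMap D R₂))
    [IsNormalDomain (R₁ ⊗[D] R₂)]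
    [CommRing S₁] [IsNormalDomain S₁] [CommRing S₂] [IsNormalDomain S₂]
    (h₁ : R₁ ⊗[D] R₂ →+* S₁) (h₂ : R₁ ⊗[D] R₂ →+* S₂) (hh₁ : h₁.Flat) (hh₂ : h₂.Flat) :
    -- the map `S0(g₁) ⊗ S0(g₂)` and the inclusions of `S0` into `Cl` are well defined
    ∃ (hT : TensorPreservesS0 D R₁ R₂) (iR₁ : S0 R₁ ⊆ Cl R₁) (iR₂ : S0 R₂ ⊆ Cl R₂)
      (iT : S0 (R₁ ⊗[D] R₂) ⊆ Cl (R₁ ⊗[D] R₂)) (iS₁ : S0 S₁ ⊆ Cl S₁) (iS₂ : S0 S₂ ⊆ Cl S₂),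
      let g₁ : R₁ →+* R₁ ⊗[D] R₂ := leftMap D R₁ R₂
      let g₂ : R₂ →+* R₁ ⊗[D] R₂ := rightMap D R₁ R₂
      let hg₁ : g₁.Flat := flat_leftMap hf₂
      let hg₂ : g₂.Flat := flat_rightMap hf₁
      let hc₁ : (h₁.comp g₁).Flat := hg₁.comp hh₁
      let hc₂ : (h₂.comp g₂).Flat := hg₂.comp hh₂
      -- the upper back face
      (Prod.map (Cl.map (h₁.comp g₁) hc₁) (Cl.map (h₂.comp g₂) hc₂) ∘
          Prod.map (Set.inclusion iR₁) (Set.inclusion iR₂) =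
        Prod.map (Set.inclusion iS₁) (Set.inclusion iS₂) ∘
          Prod.map (S0.map (h₁.comp g₁) hc₁) (S0.map (h₂.comp g₂) hc₂)) ∧
      -- the upper left face
      ((fun p : Cl R₁ × Cl R₂ => Cl.map g₁ hg₁ p.1 + Cl.map g₂ hg₂ p.2) ∘
          Prod.map (Set.inclusion iR₁) (Set.inclusion iR₂) =
        Set.inclusion iT ∘ S0.tensor hT) ∧
      -- the upper right face
      ((fun x : Cl (R₁ ⊗[D] R₂) => (Cl.map h₁ hh₁ x, Cl.map h₂ hh₂ x)) ∘ Set.inclusion iT =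
        Prod.map (Set.inclusion iS₁) (Set.inclusion iS₂) ∘
          fun x : S0 (R₁ ⊗[D] R₂) => (S0.map h₁ hh₁ x, S0.map h₂ hh₂ x)) ∧
      -- the lower back face
      (Prod.map (SBar.map (h₁.comp g₁) hc₁) (SBar.map (h₂.comp g₂) hc₂) ∘
          Prod.map SBar.mk SBar.mk =
        Prod.map SBar.mk SBar.mk ∘
          Prod.map (S0.map (h₁.comp g₁) hc₁) (S0.map (h₂.comp g₂) hc₂)) ∧
      -- the lower left face
      (SBar.tensor hT ∘ Prod.map SBar.mk SBar.mk = SBar.mk ∘ S0.tensor hT) ∧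
      -- the lower right face
      ((fun x : SBar (R₁ ⊗[D] R₂) => (SBar.map h₁ hh₁ x, SBar.map h₂ hh₂ x)) ∘ SBar.mk =
        Prod.map SBar.mk SBar.mk ∘
          fun x : S0 (R₁ ⊗[D] R₂) => (S0.map h₁ hh₁ x, S0.map h₂ hh₂ x)) := by
  refine ⟨tensorPreservesS0 hf₁ hf₂, S0_subset_Cl R₁, S0_subset_Cl R₂, S0_subset_Cl _,
    S0_subset_Cl S₁, S0_subset_Cl S₂, rfl, ?_, rfl, rfl, rfl, rfl⟩
  funext ⟨x, y⟩
  refine Subtype.ext ?_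
  have hxy := tensorPreservesS0 (D := D) hf₁ hf₂ _ x.2 _ y.2
  refine Eq.trans ?_ (Cl.dual_dual ⟨_, S0_subset_Cl _ hxy⟩)
  exact congrArg (fun z => z.dual.dual)
    (baseChange_leftMap_tensor_baseChange_rightMap (D := D) x.1 y.1)
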